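/- **Conventions.** Manifolds are smooth, finite-dimensional, Hausdorff, second countable and without boundary; submanifolds are embedded (not necessarily closed). Let $\mathfrak g$ be a real Lie algebra with an invariant symmetric element $t\in(S^2\mathfrak g)^{\mathfrak g}$, let $t^\sharp\alpha=(\alpha\otimes\mathrm{id})(t)$, and let $\phi\in\bigwedge^3\mathfrak g$ be given by $\phi(\alpha,\beta,\gamma)=\frac14\langle[t^\sharp\alpha,t^\sharp\beta],\gamma\rangle$ for $\alpha,\beta,\gamma\in\mathfrak g^*$. A *$\mathfrak g$-quasi-Poisson manifold* is a manifold $M$ with an action of $\mathfrak g$ (a Lie algebra homomorphism $\rho$ from $\mathfrak g$ to vector fields) and a $\mathfrak g$-invariant bivector field $\pi$ such that $[\pi,\pi]/2=\rho^{\otimes3}(\phi)$, where the Schouten bracket is normalised so that $\frac12[\pi,\pi](df,dg,dh)=\{f,\{g,h\}\}+\{g,\{h,f\}\}+\{h,\{f,g\}\}$ for $\{f,g\}=\pi(df,dg)$. Put $\sigma=\pi+\frac12\rho^{\otimes2}(t)$. The manifold is *quasi-Poisson-commutative* if $\sigma=0$. A function $f\in C^\infty(M)$ is *left-central* if $\sigma(df,\cdot)=0$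 and *right-central* if $\sigma(\cdot,df)=0$. A smooth $\mathfrak g$-equivariant map $F:M\to N$ from a $\mathfrak g$-quasi-Poisson manifold to a quasi-Poisson-commutative one is *left (right) central* if $f\circ F$ is left- (right-) central for every $f\in C^\infty(N)$. A *central pair* $N_L\xleftarrow{\mu_L}M\xrightarrow{\mu_R}N_R$ consists of a $\mathfrak g$-quasi-Poisson manifold $M$, a left central map $\mu_L$ and a right central map $\mu_R$. A Lie subalgebra $\mathfrak c\subset\mathfrak g$ is *coisotropic* if the image of $t$ in $S^2(\mathfrak g/\mathfrak c)$ vanishes. The $\mathfrak c$-*orbits* are the classes of the equivalence relation generated by flowing along the vector fields $\rho(u)$, $u\in\mathfrak c$, and a subset is $\mathfrak c$-*invariant* if it is a union of $\mathfrak c$-orbits. We say that *$M/\mathfrak c$ is a manifold* if there are a manifold $M/\mathfrak c$ and a surjective submersion $q:M\to M/\mathfrak c$ whose fibres are the $\mathfrak c$-orbits. A *Poisson submanifold* of a Poisson manifold $(X,\pi_X)$ is a submanifold $S$ to which $\pi_X$ is tangent, i.e. $\pi_X(\alpha,\cdot)=0$ for every conormal covector $\alpha$ of $S$. **Theorem (Central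 reduction).** Let $N_L\xleftarrow{\mu_L}M\xrightarrow{\mu_R}N_R$ be a central pair, let $\mathfrak c\subset\mathfrak g$ be a coisotropic Lie subalgebra, and let $\mathcal O_L\subset N_L$ and $\mathcal O_R\subset N_R$ be $\mathfrak c$-invariant submanifolds, of codimensions $k_L$ and $k_R$. Suppose that the map $\mu_L\times\mu_R:M\to N_L\times N_R$, $x\mapsto(\mu_L(x),\mu_R(x))$, is transverse to $\mathcal O_L\times\mathcal O_R$ and that $M/\mathfrak c$ is a manifold, with projection $q$. Then: 1. There is a Poisson bivector field $\pi_{red}$ on $M/\mathfrak c$ with $\pi_{red}(\alpha,\beta)=\pi(q^*\alpha,q^*\beta)$ for all $x\in M$ and $\alpha,\beta\in T^*_{q(x)}(M/\mathfrak c)$. 2. $P=\mu_L^{-1}(\mathcal O_L)\cap\mu_R^{-1}(\mathcal O_R)$ is a $\mathfrak c$-invariant submanifold of $M$ of codimension $k_L+k_R$. 3. $P/\mathfrak c=q(P)$ is a Poisson submanifold of $(M/\mathfrak c,\pi_{red})$ of codimension $k_L+k_R$, and $dq(T_xP)=T_{q(x)}(P/\mathfrak c)$ for every $x\in P$. -/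

import Mathlib

open scoped Manifold ContDiff TensorProduct

/-! ### Linear algebra of an element `t ∈ (S²𝔤)^𝔤`

An element of `S²𝔤` is a symmetric tensor in `𝔤 ⊗ 𝔤`. -/

section LieAlgebraData

variable {𝔤 : Type*} [LieRing 𝔤] [LieAlgebra ℝ 𝔤]

/-- `t ∈ (S²𝔤)^𝔤`: the tensor `t` is symmetric and invariant under the adjoint action. -/
structure IsInvariantSymmetric (t : 𝔤 ⊗[ℝ] 𝔤) : Prop where
  symm : TensorProduct.comm ℝ 𝔤 𝔤 t = t
  invariant : ∀ u : 𝔤, ⁅u, t⁆ = 0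

/-- The value `t(ξ, η)` of the tensor `t` on two elements of the dual of `𝔤`. -/
noncomputable def tensorEval (t : 𝔤 ⊗[ℝ] 𝔤) (ξ η : Module.Dual ℝ 𝔤) : ℝ :=
  TensorProduct.dualDistrib ℝ 𝔤 𝔤 (ξ ⊗ₜ[ℝ] η) t

/-- `t^♯ ξ = (ξ ⊗ id)(t) ∈ 𝔤`. -/
noncomputable def tensorSharp (t : 𝔤 ⊗[ℝ] 𝔤) (ξ : Module.Dual ℝ 𝔤) : 𝔤 :=
  TensorProduct.lid ℝ 𝔤 (LinearMap.rTensor 𝔤 ξ t)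

/-- The element `φ ∈ ⋀³𝔤` determined by `t`, as a trilinear form on the dual of `𝔤`:
`φ(ξ, η, ζ) = ¼ ⟨[t^♯ ξ, t^♯ η], ζ⟩`. -/
noncomputable def cartanTrivector (t : 𝔤 ⊗[ℝ] 𝔤) (ξ η ζ : Module.Dual ℝ 𝔤) : ℝ :=
  (1 / 4 : ℝ) * ζ ⁅tensorSharp t ξ, tensorSharp t η⁆

/-- A Lie subalgebra `𝔠` is coisotropic if the image of `t` in `S²(𝔤/𝔠)` vanishes. -/
def IsCoisotropic (t : 𝔤 ⊗[ℝ] 𝔤) (𝔠 : LieSubalgebra ℝ 𝔤) : Prop :=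
  TensorProduct.map 𝔠.toSubmodule.mkQ 𝔠.toSubmodule.mkQ t = 0

end LieAlgebraData

/-! ### Cotangent vectors, bivector fields, Lie algebra actions -/

section Manifolds

variable {E : Type*} [NormedAddCommGroup E] [NormedSpace ℝ E]
  {M : Type*} [TopologicalSpace M] [ChartedSpace E M]

/-- The cotangent space `T*ₓM` (of a manifold without boundary modelled on `E`). -/
abbrev Cotangent (E : Type*) [NormedAddCommGroup E] [NormedSpace ℝ E]
    {M : Type*} [TopologicalSpace M] [ChartedSpace E M] (x : M) : Type _ :=
  TangentSpace 𝓘(ℝ, E) x →L[ℝ] ℝ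

/-- The differential `dfₓ ∈ T*ₓM` of a real function. -/
noncomputable def differential (E : Type*) [NormedAddCommGroup E] [NormedSpace ℝ E]
    {M : Type*} [TopologicalSpace M] [ChartedSpace E M] (f : M → ℝ) (x : M) : Cotangent E x :=
  mfderiv 𝓘(ℝ, E) 𝓘(ℝ, ℝ) f x

/-- A smooth bivector field `π` on `M`, given by its values `π_x(α, β)` on cotangent vectors.
Smoothness is tested on differentials of smooth functions, which (on a Hausdorff manifold) is
the same as smoothness of the components of `π` in charts. -/
structure Bivector (E : Type*) [NormedAddCommGroup E] [NormedSpace ℝ E]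
    (M : Type*) [TopologicalSpace M] [ChartedSpace E M] where
  val : ∀ x : M, Cotangent E x →ₗ[ℝ] Cotangent E x →ₗ[ℝ] ℝ
  alternating : ∀ (x : M) (α : Cotangent E x), val x α α = 0
  smooth : ∀ f g : M → ℝ, ContMDiff 𝓘(ℝ, E) 𝓘(ℝ, ℝ) ∞ f → ContMDiff 𝓘(ℝ, E) 𝓘(ℝ, ℝ) ∞ g →
    ContMDiff 𝓘(ℝ, E) 𝓘(ℝ, ℝ) ∞ (fun x => val x (differential E f x) (differential E g x))

namespace Bivector

/-- The bracket of functions `{f, g} = π(df, dg)`. -/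
noncomputable def bracket (π : Bivector E M) (f g : M → ℝ) (x : M) : ℝ :=
  π.val x (differential E f x) (differential E g x)

/-- The value `([π, π]/2)(df, dg, dh) = {f, {g, h}} + {g, {h, f}} + {h, {f, g}}` of half the
Schouten bracket; here the Schouten bracket is normalised by
`[X ∧ Y, Z ∧ W] = [X, Z] ∧ Y ∧ W - [X, W] ∧ Y ∧ Z - [Y, Z] ∧ X ∧ W + [Y, W] ∧ X ∧ Z`
and `X ∧ Y = X ⊗ Y - Y ⊗ X`. -/
noncomputable def halfSchouten (π : Bivector E M) (f g h : M → ℝ) (x : M) : ℝ :=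
  π.bracket f (π.bracket g h) x + π.bracket g (π.bracket h f) x + π.bracket h (π.bracket f g) x

/-- `π` is a Poisson structure: `[π, π] = 0`. -/
def IsPoisson (π : Bivector E M) : Prop :=
  ∀ f g h : M → ℝ, ContMDiff 𝓘(ℝ, E) 𝓘(ℝ, ℝ) ∞ f → ContMDiff 𝓘(ℝ, E) 𝓘(ℝ, ℝ) ∞ g →
    ContMDiff 𝓘(ℝ, E) 𝓘(ℝ, ℝ) ∞ h → ∀ x : M, π.halfSchouten f g h x = 0

end Bivector

/-- An action `ρ` of the Lie algebra `𝔤` on `M`: a Lie algebra homomorphism from `𝔤` to smooth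
vector fields. -/
structure LieAlgebraAction (𝔤 : Type*) [LieRing 𝔤] [LieAlgebra ℝ 𝔤]
    (E : Type*) [NormedAddCommGroup E] [NormedSpace ℝ E]
    (M : Type*) [TopologicalSpace M] [ChartedSpace E M] [IsManifold 𝓘(ℝ, E) ∞ M] where
  field : 𝔤 →ₗ[ℝ] (∀ x : M, TangentSpace 𝓘(ℝ, E) x)
  smooth : ∀ u : 𝔤, ContMDiff 𝓘(ℝ, E) (𝓘(ℝ, E)).tangent ∞
    (fun x : M => (⟨x, field u x⟩ : TangentBundle 𝓘(ℝ, E) M))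
  map_lie : ∀ u v : 𝔤, field ⁅u, v⁆ = VectorField.mlieBracket 𝓘(ℝ, E) (field u) (field v)

namespace LieAlgebraAction

variable {𝔤 : Type*} [LieRing 𝔤] [LieAlgebra ℝ 𝔤] [IsManifold 𝓘(ℝ, E) ∞ M]

/-- The pull-back `ρ*α : 𝔤 → ℝ`, `u ↦ α(ρ(u)ₓ)`, of a cotangent vector `α ∈ T*ₓM`. -/
noncomputable def pullback (ρ : LieAlgebraAction 𝔤 E M) {x : M} (α : Cotangent E x) : Module.Dual ℝ 𝔤 where
  toFun u := α (ρ.field u x)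
  map_add' u v := by simp
  map_smul' r u := by simp

/-- The derivative `ρ(u) f` of a function along the action. -/
noncomputable def derive (ρ : LieAlgebraAction 𝔤 E M) (u : 𝔤) (f : M → ℝ) (x : M) : ℝ :=
  differential E f x (ρ.field u x)

/-- `y` is reached from `x` by flowing for time one along `ρ(u)` for some `u ∈ 𝔠`. -/
def FlowsTo (ρ : LieAlgebraAction 𝔤 E M) (𝔠 : LieSubalgebra ℝ 𝔤) (x y : M) : Prop :=
  ∃ u ∈ 𝔠, ∃ γ : ℝ → M,
    IsMIntegralCurveOn (I := 𝓘(ℝ, E)) γ (ρ.field u) (Set.Icc 0 1) ∧ γ 0 = x ∧ γ 1 = y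

/-- `x` and `y` lie on the same `𝔠`-orbit. -/
def SameOrbit (ρ : LieAlgebraAction 𝔤 E M) (𝔠 : LieSubalgebra ℝ 𝔤) : M → M → Prop :=
  Relation.EqvGen (ρ.FlowsTo 𝔠)

/-- A subset is `𝔠`-invariant if it is a union of `𝔠`-orbits. -/
def IsInvariantSet (ρ : LieAlgebraAction 𝔤 E M) (𝔠 : LieSubalgebra ℝ 𝔤) (S : Set M) : Prop :=
  ∀ x y : M, ρ.SameOrbit 𝔠 x y → x ∈ S → y ∈ S

/-- `q : M → M'` exhibits the manifold `M'` as the quotient `M/𝔠`: it is a surjective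
(smooth) submersion whose fibres are the `𝔠`-orbits. -/
structure IsQuotient (ρ : LieAlgebraAction 𝔤 E M) (𝔠 : LieSubalgebra ℝ 𝔤)
    (E' : Type*) [NormedAddCommGroup E'] [NormedSpace ℝ E']
    {M' : Type*} [TopologicalSpace M'] [ChartedSpace E' M'] (q : M → M') : Prop where
  submersion : Manifold.IsSubmersion 𝓘(ℝ, E) 𝓘(ℝ, E') ∞ q
  surjective : Function.Surjective q
  fibre : ∀ x y : M, q x = q y ↔ ρ.SameOrbit 𝔠 x y

end LieAlgebraAction

/-! ### Quasi-Poisson manifolds and central maps -/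

/-- A `𝔤`-quasi-Poisson structure on `M`: an action `ρ` of `𝔤` and a `𝔤`-invariant bivector field
`π` with `[π, π]/2 = ρ^{⊗3}(φ)`. -/
structure QuasiPoisson {𝔤 : Type*} [LieRing 𝔤] [LieAlgebra ℝ 𝔤] (t : 𝔤 ⊗[ℝ] 𝔤)
    (E : Type*) [NormedAddCommGroup E] [NormedSpace ℝ E]
    (M : Type*) [TopologicalSpace M] [ChartedSpace E M] [IsManifold 𝓘(ℝ, E) ∞ M] where
  ρ : LieAlgebraAction 𝔤 E M
  π : Bivector E M
  invariant : ∀ (u : 𝔤) (f g : M → ℝ),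
    ContMDiff 𝓘(ℝ, E) 𝓘(ℝ, ℝ) ∞ f → ContMDiff 𝓘(ℝ, E) 𝓘(ℝ, ℝ) ∞ g → ∀ x : M,
      ρ.derive u (π.bracket f g) x =
        π.bracket (ρ.derive u f) g x + π.bracket f (ρ.derive u g) x
  schouten : ∀ f g h : M → ℝ,
    ContMDiff 𝓘(ℝ, E) 𝓘(ℝ, ℝ) ∞ f → ContMDiff 𝓘(ℝ, E) 𝓘(ℝ, ℝ) ∞ g →
    ContMDiff 𝓘(ℝ, E) 𝓘(ℝ, ℝ) ∞ h → ∀ x : M,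
      π.halfSchouten f g h x =
        cartanTrivector t (ρ.pullback (differential E f x)) (ρ.pullback (differential E g x))
          (ρ.pullback (differential E h x))

namespace QuasiPoisson

variable {𝔤 : Type*} [LieRing 𝔤] [LieAlgebra ℝ 𝔤] {t : 𝔤 ⊗[ℝ] 𝔤} [IsManifold 𝓘(ℝ, E) ∞ M]
  {F : Type*} [NormedAddCommGroup F] [NormedSpace ℝ F]
  {N : Type*} [TopologicalSpace N] [ChartedSpace F N] [IsManifold 𝓘(ℝ, F) ∞ N]

/-- `σ = π + ½ ρ^{⊗2}(t)`. -/
noncomputable def σ (Q : QuasiPoisson t E M) (x : M) (α β : Cotangent E x) : ℝ :=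
  Q.π.val x α β + (1 / 2 : ℝ) * tensorEval t (Q.ρ.pullback α) (Q.ρ.pullback β)

/-- A quasi-Poisson manifold is quasi-Poisson-commutative if `σ = 0`. -/
def IsCommutative (Q : QuasiPoisson t E M) : Prop :=
  ∀ (x : M) (α β : Cotangent E x), Q.σ x α β = 0

/-- A function `f` is left-central if `σ(df, ·) = 0`. -/
def IsLeftCentralFun (Q : QuasiPoisson t E M) (f : M → ℝ) : Prop :=
  ∀ (x : M) (β : Cotangent E x), Q.σ x (differential E f x) β = 0

/-- A function `f` is right-central if `σ(·, df) = 0`. -/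
def IsRightCentralFun (Q : QuasiPoisson t E M) (f : M → ℝ) : Prop :=
  ∀ (x : M) (α : Cotangent E x), Q.σ x α (differential E f x) = 0

/-- A smooth map intertwining the actions of `𝔤`. -/
structure IsEquivariant (Q : QuasiPoisson t E M) (R : QuasiPoisson t F N) (μ : M → N) :
    Prop where
  smooth : ContMDiff 𝓘(ℝ, E) 𝓘(ℝ, F) ∞ μ
  map_field : ∀ (u : 𝔤) (x : M),
    mfderiv 𝓘(ℝ, E) 𝓘(ℝ, F) μ x (Q.ρ.field u x) = R.ρ.field u (μ x)

/-- Left central maps, from a quasi-Poisson to a quasi-Poisson-commutative manifold. -/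
structure IsLeftCentral (Q : QuasiPoisson t E M) (R : QuasiPoisson t F N) (μ : M → N) :
    Prop where
  target_commutative : R.IsCommutative
  equivariant : Q.IsEquivariant R μ
  central : ∀ f : N → ℝ, ContMDiff 𝓘(ℝ, F) 𝓘(ℝ, ℝ) ∞ f → Q.IsLeftCentralFun (f ∘ μ)

/-- Right central maps, from a quasi-Poisson to a quasi-Poisson-commutative manifold. -/
structure IsRightCentral (Q : QuasiPoisson t E M) (R : QuasiPoisson t F N) (μ : M → N) :
    Prop where
  target_commutative : R.IsCommutative
  equivariant : Q.IsEquivariant R μ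
  central : ∀ f : N → ℝ, ContMDiff 𝓘(ℝ, F) 𝓘(ℝ, ℝ) ∞ f → Q.IsRightCentralFun (f ∘ μ)

/-- A central pair `N_L ← M → N_R`. -/
structure IsCentralPair {F' : Type*} [NormedAddCommGroup F'] [NormedSpace ℝ F']
    {N' : Type*} [TopologicalSpace N'] [ChartedSpace F' N'] [IsManifold 𝓘(ℝ, F') ∞ N']
    (Q : QuasiPoisson t E M) (QL : QuasiPoisson t F N) (QR : QuasiPoisson t F' N')
    (μL : M → N) (μR : M → N') : Prop where
  left : Q.IsLeftCentral QL μL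
  right : Q.IsRightCentral QR μR

end QuasiPoisson

/-! ### Submanifolds -/

/-- `S` is an (embedded, not necessarily closed) submanifold of codimension `k`: locally it is the
zero set of a smooth map to `ℝᵏ` whose differential is onto. -/
def IsSubmanifold (E : Type*) [NormedAddCommGroup E] [NormedSpace ℝ E]
    {M : Type*} [TopologicalSpace M] [ChartedSpace E M] (k : ℕ) (S : Set M) : Prop :=
  ∀ x ∈ S, ∃ (U : Set M) (h : M → (Fin k → ℝ)), IsOpen U ∧ x ∈ U ∧
    ContMDiffOn 𝓘(ℝ, E) 𝓘(ℝ, Fin k → ℝ) ∞ h U ∧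
    (∀ y ∈ S ∩ U, Function.Surjective (mfderiv 𝓘(ℝ, E) 𝓘(ℝ, Fin k → ℝ) h y)) ∧
    S ∩ U = {y ∈ U | h y = 0}

/-- The tangent space `TₓS ⊂ TₓM` of a submanifold `S ⊂ M` at `x ∈ S`: the vectors that annihilate
all smooth functions on `M` vanishing on `S`. -/
def submanifoldTangent (E : Type*) [NormedAddCommGroup E] [NormedSpace ℝ E]
    {M : Type*} [TopologicalSpace M] [ChartedSpace E M] (S : Set M) (x : M) :
    Submodule ℝ (TangentSpace 𝓘(ℝ, E) x) where
  carrier := {v | ∀ f : M → ℝ, ContMDiff 𝓘(ℝ, E) 𝓘(ℝ, ℝ) ∞ f → (∀ y ∈ S, f y = 0) →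
    differential E f x v = 0}
  add_mem' ha hb f hf hS := by simp [ha f hf hS, hb f hf hS]
  zero_mem' f _ _ := by simp
  smul_mem' r v hv f hf hS := by simp [hv f hf hS]

/-- `S` is a Poisson submanifold for the Poisson bivector field `π`: a submanifold to which `π`
is tangent, `π_x ∈ ⋀²TₓS` for `x ∈ S`, i.e. `π_x(α, ·) = 0` for conormal vectors `α` of `S`. -/
def IsPoissonSubmanifold (π : Bivector E M) (k : ℕ) (S : Set M) : Prop :=
  IsSubmanifold E k S ∧ ∀ x ∈ S, ∀ α β : Cotangent E x,
    (∀ v ∈ submanifoldTangent E S x, α v = 0) → π.val x α β = 0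

/-- The map `μ₁ × μ₂ : M → N₁ × N₂`, `x ↦ (μ₁ x, μ₂ x)`, is transverse to `O₁ × O₂`:
`im d(μ₁ × μ₂)ₓ + T(O₁ × O₂) = T(N₁ × N₂)` whenever `(μ₁ x, μ₂ x) ∈ O₁ × O₂`. -/
def IsTransverseToProd
    (F₁ : Type*) [NormedAddCommGroup F₁] [NormedSpace ℝ F₁]
    {N₁ : Type*} [TopologicalSpace N₁] [ChartedSpace F₁ N₁]
    (F₂ : Type*) [NormedAddCommGroup F₂] [NormedSpace ℝ F₂]
    {N₂ : Type*} [TopologicalSpace N₂] [ChartedSpace F₂ N₂]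
    (E : Type*) [NormedAddCommGroup E] [NormedSpace ℝ E]
    {M : Type*} [TopologicalSpace M] [ChartedSpace E M]
    (μ₁ : M → N₁) (μ₂ : M → N₂) (O₁ : Set N₁) (O₂ : Set N₂) : Prop :=
  ∀ x : M, μ₁ x ∈ O₁ → μ₂ x ∈ O₂ →
    LinearMap.range ((mfderiv 𝓘(ℝ, E) 𝓘(ℝ, F₁) μ₁ x).toLinearMap.prod
        (mfderiv 𝓘(ℝ, E) 𝓘(ℝ, F₂) μ₂ x).toLinearMap) ⊔
      (submanifoldTangent F₁ O₁ (μ₁ x)).prod (submanifoldTangent F₂ O₂ (μ₂ x)) = ⊤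

end Manifolds

/-! Covectors that annihilate the `𝔠`-directions carry the whole argument. On two of them `t`
vanishes because `𝔠` is coisotropic (`IsCoisotropic.tensorEval_eq_zero`), so `π` and `σ` agree
there. On three of them `φ` vanishes, since `t^♯` sends them into the subalgebra `𝔠`
(`IsCoisotropic.cartanTrivector_eq_zero`). Covectors pulled back along `q` are of this kind.
Invariance of `π` makes brackets of pulled-back functions constant on the fibres, so `π` descends
(`Bivector.exists_descent`), and the Jacobiator of the quotient is the vanishing `φ` term
(`Bivector.isPoisson_of_descent`).

By transversality, a conormal covector of `P` is a sum of pull-backs of conormal covectors of `O_L`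
and `O_R` (`IsDefiningMap.exists_conormal_decomposition`). These annihilate the `𝔠`-directions
because the submanifolds are invariant and the maps equivariant. Paired with any `q*β`, `π` may be
replaced by `σ`, which kills the left summand in its first slot and the right one in its second;
antisymmetry of `π` combines the two (`IsLeftCentral.val_eq_zero`, `IsRightCentral.val_eq_zero`).

The differential geometry rests on local defining maps: their kernels are the tangent spaces
(`mem_submanifoldTangent_iff`), transversality pulls them back to `P` (`IsDefiningMap.prod`), and
composition with a local section of `q` carries them to `q(P)` (`image_of_section`). -/

open scoped Topology

/-! ### Extension of functions, Lagrange multipliers, local sections of submersions -/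

section DifferentialGeometry

variable {E : Type*} [NormedAddCommGroup E] [NormedSpace ℝ E]
  {M : Type*} [TopologicalSpace M] [ChartedSpace E M]
  {F : Type*} [NormedAddCommGroup F] [NormedSpace ℝ F]
  {N : Type*} [TopologicalSpace N] [ChartedSpace F N]

/-- Multiply by a bump function supported in `U`. The last clause ensures that if `h` vanishes on `S
∩ U`, the extension vanishes on all of `S`, even when `S` is not closed. -/
theorem exists_contMDiff_eventuallyEq_of_contMDiffOn [FiniteDimensional ℝ E] [T2Space M]
    [IsManifold 𝓘(ℝ, E) ∞ M] {U : Set M} (hU : IsOpen U) {x : M} (hx : x ∈ U) {h : M → ℝ}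
    (hh : ContMDiffOn 𝓘(ℝ, E) 𝓘(ℝ, ℝ) ∞ h U) :
    ∃ f : M → ℝ, ContMDiff 𝓘(ℝ, E) 𝓘(ℝ, ℝ) ∞ f ∧ f =ᶠ[𝓝 x] h ∧
      ∀ y, (y ∈ U → h y = 0) → f y = 0 := by
  obtain ⟨φ, hφ, -⟩ := (SmoothBumpFunction.nhds_basis_support (I := 𝓘(ℝ, E))
    (hU.mem_nhds hx)).mem_iff.1 (hU.mem_nhds hx)
  refine ⟨fun y => φ y • h y, ?_, ?_, ?_⟩
  · refine contMDiff_of_tsupport fun y hy => ?_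
    have hyU : y ∈ U := hφ (tsupport_smul_subset_left _ _ hy)
    exact φ.contMDiffAt.smul (hh.contMDiffAt (hU.mem_nhds hyU))
  · filter_upwards [φ.eventuallyEq_one] with y hy
    simp [hy]
  · intro y hy
    by_cases hyU : y ∈ U
    · simp [hy hyU]
    · have : φ y = 0 := by
        by_contra h0
        exact hyU (hφ (subset_tsupport _ h0))
      simp [this]

/-- Cut off the linear function `α` of the chart at `x`. Centrality, invariance and smoothness are
tested only on differentials of global functions; this passes from them to arbitrary covectors. -/
theorem exists_differential_eq [FiniteDimensional ℝ E] [T2Space M]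
    [IsManifold 𝓘(ℝ, E) ∞ M] (x : M) (α : Cotangent E x) :
    ∃ f : M → ℝ, ContMDiff 𝓘(ℝ, E) 𝓘(ℝ, ℝ) ∞ f ∧ differential E f x = α := by
  let a : E →L[ℝ] ℝ := α
  have hsm : ContMDiffOn 𝓘(ℝ, E) 𝓘(ℝ, ℝ) ∞ (fun y => a (extChartAt 𝓘(ℝ, E) x y))
      (chartAt E x).source :=
    a.contDiff.contMDiff.comp_contMDiffOn (contMDiffOn_extChartAt (n := ∞))
  obtain ⟨f, hf, hfe, -⟩ := exists_contMDiff_eventuallyEq_of_contMDiffOn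
    (chartAt E x).open_source (mem_chart_source E x) hsm
  refine ⟨f, hf, ?_⟩
  have hd : MDifferentiableAt 𝓘(ℝ, E) 𝓘(ℝ, ℝ) (fun y => a (extChartAt 𝓘(ℝ, E) x y)) x :=
    ((hsm.contMDiffAt ((chartAt E x).open_source.mem_nhds (mem_chart_source E x))).mdifferentiableAt
      (by simp))
  unfold differential
  rw [hfe.mfderiv_eq, hd.mfderiv]
  have hw : writtenInExtChartAt 𝓘(ℝ, E) 𝓘(ℝ, ℝ) x (fun y => a (extChartAt 𝓘(ℝ, E) x y))
      =ᶠ[𝓝 (extChartAt 𝓘(ℝ, E) x x)] a := by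
    filter_upwards [extChartAt_target_mem_nhds (I := 𝓘(ℝ, E)) x] with z hz
    have := (extChartAt 𝓘(ℝ, E) x).right_inv hz
    simp only [writtenInExtChartAt, Function.comp, this]
    rfl
  simp only [modelWithCornersSelf_coe, Set.range_id, fderivWithin_univ]
  exact hw.fderiv_eq.trans a.fderiv

/-- A function which is locally constant on the fibres of `g` has a differential that
annihilates the kernel of the differential of `g`, where the latter is onto. -/
theorem mfderiv_apply_eq_zero_of_constant_on_fibre [CompleteSpace E] [CompleteSpace F]
    {W : Type*} [NormedAddCommGroup W] [NormedSpace ℝ W]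
    {g : M → N} {f : M → W} {x : M}
    (hg : ContMDiffAt 𝓘(ℝ, E) 𝓘(ℝ, F) ∞ g x) (hf : ContMDiffAt 𝓘(ℝ, E) 𝓘(ℝ, W) ∞ f x)
    (hsurj : Function.Surjective (mfderiv 𝓘(ℝ, E) 𝓘(ℝ, F) g x))
    (hfib : ∀ᶠ y in 𝓝 x, g y = g x → f y = f x)
    {v : TangentSpace 𝓘(ℝ, E) x} (hv : mfderiv 𝓘(ℝ, E) 𝓘(ℝ, F) g x v = 0) :
    mfderiv 𝓘(ℝ, E) 𝓘(ℝ, W) f x v = 0 := by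
  have hgd := hg.mdifferentiableAt (by simp)
  have hfd := hf.mdifferentiableAt (by simp)
  set z₀ : E := extChartAt 𝓘(ℝ, E) x x with hz₀
  have hg2 := (contMDiffAt_iff.1 hg).2
  have hf2 := (contMDiffAt_iff.1 hf).2
  rw [hgd.mfderiv] at hsurj hv
  rw [hfd.mfderiv]
  simp only [modelWithCornersSelf_coe, Set.range_id, fderivWithin_univ,
    contDiffWithinAt_univ] at hsurj hv hg2 hf2 ⊢
  set G : E → F := writtenInExtChartAt 𝓘(ℝ, E) 𝓘(ℝ, F) x g with hG
  set Φ : E → W := writtenInExtChartAt 𝓘(ℝ, E) 𝓘(ℝ, W) x f with hΦ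
  have hGs : HasStrictFDerivAt G (fderiv ℝ G z₀) z₀ :=
    ContDiffAt.hasStrictFDerivAt hg2 (by simp)
  have hΦs : HasStrictFDerivAt Φ (fderiv ℝ Φ z₀) z₀ :=
    ContDiffAt.hasStrictFDerivAt hf2 (by simp)
  have hsymm : (extChartAt 𝓘(ℝ, E) x).symm z₀ = x := extChartAt_to_inv x
  have htend : Filter.Tendsto (extChartAt 𝓘(ℝ, E) x).symm (𝓝 z₀) (𝓝 x) := by
    have := (continuousAt_extChartAt_symm (I := 𝓘(ℝ, E)) x).tendsto
    rwa [hsymm] at this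
  have hev : ∀ᶠ z in 𝓝 z₀, G z = G z₀ → Φ z = Φ z₀ := by
    have hsrc : ∀ᶠ y in 𝓝 x, g y ∈ (extChartAt 𝓘(ℝ, F) (g x)).source :=
      hg.continuousAt.eventually (extChartAt_source_mem_nhds (I := 𝓘(ℝ, F)) (g x))
    filter_upwards [htend.eventually hfib, htend.eventually hsrc] with z hz hzs hGz
    simp only [hG, hΦ, writtenInExtChartAt, Function.comp, hsymm] at hGz ⊢
    rw [hz ((extChartAt 𝓘(ℝ, F) (g x)).injOn hzs (mem_extChartAt_source _) hGz)]
  refine SeparatingDual.eq_zero_of_forall_dual_eq_zero (R := ℝ) (V := W) fun ℓ => ?_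
  have hℓ : HasStrictFDerivAt (fun z => ℓ (Φ z)) (ℓ.comp (fderiv ℝ Φ z₀)) z₀ :=
    ℓ.hasStrictFDerivAt.comp z₀ hΦs
  -- A function constant on the level set of `G` has a local extremum there, so there are
  -- multipliers with `Λ ∘ dG + Λ₀ ℓ ∘ dΦ = 0`, not both zero. At `v` the first term drops out, and
  -- `Λ₀ = 0` would force `Λ = 0` because `dG` is onto.
  have hext : IsLocalExtrOn (fun z => ℓ (Φ z)) {z | G z = G z₀} z₀ := by
    left
    refine eventually_nhdsWithin_iff.2 ?_
    filter_upwards [hev] with z hz hzm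
    rw [hz hzm]
  obtain ⟨Λ, Λ₀, hne, hΛ⟩ := hext.exists_linear_map_of_hasStrictFDerivAt hGs hℓ
  have hΛv := hΛ v
  have hv' : fderiv ℝ G z₀ v = 0 := hv
  rw [hv', map_zero, zero_add, smul_eq_mul, mul_eq_zero] at hΛv
  rcases hΛv with h0 | h0
  · exfalso
    refine hne ?_
    have : Λ = 0 := by
      ext w
      obtain ⟨v', hv'⟩ := hsurj w
      have := hΛ v'
      rw [h0, zero_smul, add_zero] at this
      rw [← hv']
      exact this
    rw [this, h0]; rfl
  · exact h0

theorem Manifold.IsSubmersionAt.exists_section [IsManifold 𝓘(ℝ, E) ∞ M]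
    [IsManifold 𝓘(ℝ, F) ∞ N] {q : M → N} {x : M}
    (hq : Manifold.IsSubmersionAt 𝓘(ℝ, E) 𝓘(ℝ, F) ∞ q x) :
    ∃ (V : Set N) (s : N → M), IsOpen V ∧ q x ∈ V ∧ ContMDiffOn 𝓘(ℝ, F) 𝓘(ℝ, E) ∞ s V ∧
      s (q x) = x ∧ ∀ y ∈ V, q (s y) = y := by
  have hφ := hq.domChart_mem_maximalAtlas
  have hψ := hq.codChart_mem_maximalAtlas
  have hx := hq.mem_domChart_source
  have hqx := hq.source_subset_preimage_source hx
  have hsub := hq.source_subset_preimage_source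
  have hwr := hq.writtenInCharts
  set φ := hq.domChart
  set ψ := hq.codChart
  set e := hq.equiv
  simp only [OpenPartialHomeomorph.extend, modelWithCornersSelf_partialEquiv,
    PartialEquiv.trans_refl] at hwr
  have hwr' : ∀ z ∈ φ.target, ψ (q (φ.symm z)) = (e z).1 := fun z hz => hwr hz
  -- In adapted charts `q` is a projection; the section freezes the complementary coordinate at its
  -- value at `x`.
  let j : F → E := fun w => e.symm (w, (e (φ x)).2)
  have hj : ContMDiff 𝓘(ℝ, F) 𝓘(ℝ, E) ∞ j :=
    (e.symm.contDiff.comp (contDiff_id.prodMk contDiff_const)).contMDiff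
  have hψx : ψ (q x) = (e (φ x)).1 := by
    have := hwr' (φ x) (φ.map_source hx)
    rwa [φ.left_inv hx] at this
  have hjx : j (ψ (q x)) = φ x := by
    simp only [j, hψx, Prod.mk.eta, ContinuousLinearEquiv.symm_apply_apply]
  refine ⟨ψ.source ∩ ψ ⁻¹' (j ⁻¹' φ.target), fun y => φ.symm (j (ψ y)), ?_, ?_, ?_, ?_, ?_⟩
  · exact ψ.isOpen_inter_preimage (hj.continuous.isOpen_preimage _ φ.open_target)
  · refine ⟨hqx, ?_⟩
    simp only [Set.mem_preimage, hjx]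
    exact φ.map_source hx
  · exact (contMDiffOn_symm_of_mem_maximalAtlas hφ).comp
      (hj.comp_contMDiffOn ((contMDiffOn_of_mem_maximalAtlas hψ).mono Set.inter_subset_left))
      (fun y hy => hy.2)
  · simp only [hjx, φ.left_inv hx]
  · intro y hy
    have h1 : ψ (q (φ.symm (j (ψ y)))) = ψ y := by
      rw [hwr' _ hy.2]; simp [j]
    exact ψ.injOn (hsub (φ.map_target hy.2)) hy.1 h1

end DifferentialGeometry

theorem ContinuousLinearMap.comp_smulRight_one {E F : Type*} [NormedAddCommGroup E]
    [NormedSpace ℝ E] [NormedAddCommGroup F] [NormedSpace ℝ F] (A : E →L[ℝ] F) (v : E) :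
    A.comp ((1 : ℝ →L[ℝ] ℝ).smulRight v) = (1 : ℝ →L[ℝ] ℝ).smulRight (A v) := by
  ext
  simp

/-! ### Orbits of the action and equivariant maps -/

section Orbits

variable {E : Type*} [NormedAddCommGroup E] [NormedSpace ℝ E]
  {M : Type*} [TopologicalSpace M] [ChartedSpace E M]
  {F : Type*} [NormedAddCommGroup F] [NormedSpace ℝ F]
  {N : Type*} [TopologicalSpace N] [ChartedSpace F N]
  {𝔤 : Type*} [LieRing 𝔤] [LieAlgebra ℝ 𝔤] [IsManifold 𝓘(ℝ, E) ∞ M]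

namespace LieAlgebraAction

theorem exists_curve_in_orbit [CompleteSpace E] [T2Space M] (ρ : LieAlgebraAction 𝔤 E M)
    {𝔠 : LieSubalgebra ℝ 𝔤} {u : 𝔤} (hu : u ∈ 𝔠) (x : M) :
    ∃ γ : ℝ → M, γ 0 = x ∧
      HasMFDerivAt 𝓘(ℝ, ℝ) 𝓘(ℝ, E) γ 0 ((1 : ℝ →L[ℝ] ℝ).smulRight (ρ.field u (γ 0))) ∧
      ∀ᶠ s in 𝓝 (0 : ℝ), ρ.SameOrbit 𝔠 x (γ s) := by
  have : IsManifold 𝓘(ℝ, E) 1 M := IsManifold.of_le (n := ∞) (by simp)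
  have hv : ContMDiffAt 𝓘(ℝ, E) (𝓘(ℝ, E)).tangent 1
      (fun x : M => (⟨x, ρ.field u x⟩ : TangentBundle 𝓘(ℝ, E) M)) x :=
    ((ρ.smooth u).of_le (by simp)) x
  obtain ⟨γ, hγ0, hγ⟩ := exists_isMIntegralCurveAt_of_contMDiffAt_boundaryless (t₀ := 0) hv
  refine ⟨γ, hγ0, hγ.hasMFDerivAt, ?_⟩
  obtain ⟨ε, hε, hball⟩ := isMIntegralCurveAt_iff'.1 hγ
  filter_upwards [Metric.ball_mem_nhds (0 : ℝ) hε] with s hs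
  -- The point `γ s` is reached in time one along `s • u`, by the rescaled curve `τ ↦ γ (τ s)`.
  refine Relation.EqvGen.rel _ _ ⟨s • u, 𝔠.smul_mem s hu, γ ∘ (· * s), ?_, by simp [hγ0], by simp⟩
  have h := (hball.comp_mul s).mono (s' := Set.Icc 0 1) ?_
  · rw [map_smul]; exact h
  · rintro τ ⟨h0, h1⟩
    simp only [Metric.mem_ball, dist_zero_right, Real.norm_eq_abs, Set.mem_ofPred_eq, abs_mul] at hs ⊢
    calc |τ| * |s| ≤ 1 * |s| := by
          gcongr
          rw [abs_of_nonneg h0]; exact h1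
      _ < ε := by simpa using hs

/-- A map which is constant on an orbit has a differential that annihilates the directions of
the action. -/
theorem mfderiv_field_eq_zero [CompleteSpace E] [T2Space M] (ρ : LieAlgebraAction 𝔤 E M)
    {𝔠 : LieSubalgebra ℝ 𝔤} {u : 𝔤} (hu : u ∈ 𝔠) {x : M} {g : M → N}
    (hg : MDifferentiableAt 𝓘(ℝ, E) 𝓘(ℝ, F) g x)
    (hconst : ∀ y, ρ.SameOrbit 𝔠 x y → g y = g x) :
    mfderiv 𝓘(ℝ, E) 𝓘(ℝ, F) g x (ρ.field u x) = 0 := by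
  obtain ⟨γ, rfl, hγ, horb⟩ := ρ.exists_curve_in_orbit hu x
  have h1 := hg.hasMFDerivAt.comp (0 : ℝ) hγ
  have h2 : HasMFDerivAt 𝓘(ℝ, ℝ) 𝓘(ℝ, F) (g ∘ γ) 0 0 :=
    (hasMFDerivAt_const (g (γ 0)) (0 : ℝ)).congr_of_eventuallyEq (by
      filter_upwards [horb] with s hs
      exact hconst _ hs)
  have h3 := hasMFDerivAt_unique h1 h2
  have h4 : (1 : ℝ →L[ℝ] ℝ).smulRight
      (show F from mfderiv 𝓘(ℝ, E) 𝓘(ℝ, F) g (γ 0) (ρ.field u (γ 0))) = 0 :=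
    (ContinuousLinearMap.comp_smulRight_one (E := E) (F := F) _ _).symm.trans h3
  have h5 := DFunLike.congr_fun h4 (1 : ℝ)
  exact (one_smul ℝ _).symm.trans h5

/-- Along an integral curve of `ρ(u)` the derivative of `f` is `ρ(u) f = 0`. This integrates
infinitesimal invariance to constancy on orbits. -/
theorem eq_of_sameOrbit (ρ : LieAlgebraAction 𝔤 E M) {𝔠 : LieSubalgebra ℝ 𝔤} {f : M → ℝ}
    (hf : MDifferentiable 𝓘(ℝ, E) 𝓘(ℝ, ℝ) f)
    (hder : ∀ u ∈ 𝔠, ∀ x, ρ.derive u f x = 0) {x y : M} (hxy : ρ.SameOrbit 𝔠 x y) :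
    f x = f y := by
  induction hxy with
  | rel x y h =>
    obtain ⟨u, hu, γ, hγ, rfl, rfl⟩ := h
    have hd : ∀ s ∈ Set.Icc (0 : ℝ) 1, HasDerivWithinAt (f ∘ γ) 0 (Set.Icc 0 1) s := by
      intro s hs
      have h1 := (hf (γ s)).hasMFDerivAt.comp_hasMFDerivWithinAt s (hγ s hs)
      let A : E →L[ℝ] ℝ := mfderiv 𝓘(ℝ, E) 𝓘(ℝ, ℝ) f (γ s)
      let v : E := ρ.field u (γ s)
      have h2 : HasFDerivWithinAt (f ∘ γ) (A.comp ((1 : ℝ →L[ℝ] ℝ).smulRight v))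
          (Set.Icc 0 1) s := hasMFDerivWithinAt_iff_hasFDerivWithinAt.1 h1
      have h3 : A v = 0 := hder u hu (γ s)
      rw [A.comp_smulRight_one] at h2
      have h4 := h2.hasDerivWithinAt
      refine h4.congr_deriv ((one_smul ℝ _).trans h3)
    exact (constant_of_derivWithin_zero (fun s hs => (hd s hs).differentiableWithinAt)
      (fun s hs => (hd s ⟨hs.1, hs.2.le⟩).derivWithin
        (uniqueDiffOn_Icc zero_lt_one s ⟨hs.1, hs.2.le⟩)) 1 (by simp)).symm
  | refl x => rfl
  | symm x y _ ih => exact ih.symm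
  | trans x y z _ _ ih1 ih2 => exact ih1.trans ih2

/-- A vector of the action of `𝔠` at a point of a `𝔠`-invariant set is tangent to that set. -/
theorem IsInvariantSet.field_mem_submanifoldTangent [CompleteSpace E] [T2Space M]
    {ρ : LieAlgebraAction 𝔤 E M} {𝔠 : LieSubalgebra ℝ 𝔤} {S : Set M}
    (hS : ρ.IsInvariantSet 𝔠 S) {u : 𝔤} (hu : u ∈ 𝔠) {x : M} (hx : x ∈ S) :
    ρ.field u x ∈ submanifoldTangent E S x := by
  intro f hf hfS
  refine ρ.mfderiv_field_eq_zero hu ((hf x).mdifferentiableAt (by simp)) fun y hy => ?_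
  rw [hfS y (hS x y hy hx), hfS x hx]

end LieAlgebraAction

namespace QuasiPoisson

variable {t : 𝔤 ⊗[ℝ] 𝔤} [IsManifold 𝓘(ℝ, F) ∞ N]

/-- An equivariant map sends integral curves of `ρ(u)` to integral curves of `ρ(u)`. -/
theorem IsEquivariant.sameOrbit {Q : QuasiPoisson t E M} {R : QuasiPoisson t F N} {μ : M → N}
    (hμ : Q.IsEquivariant R μ) {𝔠 : LieSubalgebra ℝ 𝔤} {x y : M}
    (hxy : Q.ρ.SameOrbit 𝔠 x y) : R.ρ.SameOrbit 𝔠 (μ x) (μ y) := by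
  induction hxy with
  | rel x y h =>
    obtain ⟨u, hu, γ, hγ, rfl, rfl⟩ := h
    refine Relation.EqvGen.rel _ _ ⟨u, hu, μ ∘ γ, fun s hs => ?_, rfl, rfl⟩
    have h1 := ((hμ.smooth (γ s)).mdifferentiableAt (by simp)).hasMFDerivAt.comp_hasMFDerivWithinAt
      s (hγ s hs)
    refine h1.congr_mfderiv
      ((ContinuousLinearMap.comp_smulRight_one (E := E) (F := F) _ _).trans ?_)
    exact congrArg (ContinuousLinearMap.smulRight (M₂ := F) (1 : ℝ →L[ℝ] ℝ))
      (hμ.map_field u (γ s))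
  | refl x => exact Relation.EqvGen.refl _
  | symm x y _ ih => exact Relation.EqvGen.symm _ _ ih
  | trans x y z _ _ ih1 ih2 => exact Relation.EqvGen.trans _ _ _ ih1 ih2

theorem IsEquivariant.isInvariantSet_preimage {Q : QuasiPoisson t E M} {R : QuasiPoisson t F N}
    {μ : M → N} (hμ : Q.IsEquivariant R μ) {𝔠 : LieSubalgebra ℝ 𝔤} {S : Set N}
    (hS : R.ρ.IsInvariantSet 𝔠 S) : Q.ρ.IsInvariantSet 𝔠 (μ ⁻¹' S) :=
  fun _ _ hxy hx => hS _ _ (hμ.sameOrbit hxy) hx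

end QuasiPoisson

end Orbits

/-! ### Local defining maps of submanifolds and transverse preimages -/

section DefiningMaps

variable {E : Type*} [NormedAddCommGroup E] [NormedSpace ℝ E]
  {M : Type*} [TopologicalSpace M] [ChartedSpace E M]
  {F : Type*} [NormedAddCommGroup F] [NormedSpace ℝ F]
  {N : Type*} [TopologicalSpace N] [ChartedSpace F N]
  {W : Type*} [NormedAddCommGroup W] [NormedSpace ℝ W]

/-- The chain rule with a free base point `y`: the points met later are only propositionally equal,
so values are compared in the model spaces. -/
theorem mfderiv_comp_apply_model {F' : Type*} [NormedAddCommGroup F'] [NormedSpace ℝ F']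
    {N' : Type*} [TopologicalSpace N'] [ChartedSpace F' N'] {g : N → N'} {f : M → N} {x : M} {y : N}
    (hg : MDifferentiableAt 𝓘(ℝ, F) 𝓘(ℝ, F') g y) (hf : MDifferentiableAt 𝓘(ℝ, E) 𝓘(ℝ, F) f x)
    (hy : f x = y) (v : TangentSpace 𝓘(ℝ, E) x) :
    (mfderiv 𝓘(ℝ, E) 𝓘(ℝ, F') (g ∘ f) x v : F') =
      mfderiv 𝓘(ℝ, F) 𝓘(ℝ, F') g y (mfderiv 𝓘(ℝ, E) 𝓘(ℝ, F) f x v : F) := by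
  subst hy
  rw [mfderiv_comp x hg hf]
  rfl

theorem mfderiv_prodMk_comp_apply {F' : Type*} [NormedAddCommGroup F'] [NormedSpace ℝ F']
    {N' : Type*} [TopologicalSpace N'] [ChartedSpace F' N']
    {W' : Type*} [NormedAddCommGroup W'] [NormedSpace ℝ W']
    {h₁ : N → W} {h₂ : N' → W'} {μ₁ : M → N} {μ₂ : M → N'} {y : M}
    (hd₁ : MDifferentiableAt 𝓘(ℝ, F) 𝓘(ℝ, W) h₁ (μ₁ y))
    (hd₂ : MDifferentiableAt 𝓘(ℝ, F') 𝓘(ℝ, W') h₂ (μ₂ y))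
    (hm₁ : MDifferentiableAt 𝓘(ℝ, E) 𝓘(ℝ, F) μ₁ y) (hm₂ : MDifferentiableAt 𝓘(ℝ, E) 𝓘(ℝ, F') μ₂ y)
    (v : TangentSpace 𝓘(ℝ, E) y) :
    (mfderiv 𝓘(ℝ, E) 𝓘(ℝ, W × W') (fun x => (h₁ (μ₁ x), h₂ (μ₂ x))) y v : W × W') =
      ((mfderiv 𝓘(ℝ, F) 𝓘(ℝ, W) h₁ (μ₁ y) (mfderiv 𝓘(ℝ, E) 𝓘(ℝ, F) μ₁ y v) : W),
        (mfderiv 𝓘(ℝ, F') 𝓘(ℝ, W') h₂ (μ₂ y) (mfderiv 𝓘(ℝ, E) 𝓘(ℝ, F') μ₂ y v) : W')) := by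
  have h1 := hd₁.hasMFDerivAt.comp y hm₁.hasMFDerivAt
  have h2 := hd₂.hasMFDerivAt.comp y hm₂.hasMFDerivAt
  have h3 : HasMFDerivAt 𝓘(ℝ, E) 𝓘(ℝ, W × W') (fun x => (h₁ (μ₁ x), h₂ (μ₂ x))) y _ :=
    ⟨h1.1.prodMk h2.1, h1.2.prodMk h2.2⟩
  exact DFunLike.congr_fun h3.mfderiv v

/-- On the open set `U`, the subset `S` is the zero set of the smooth map `h : M → W`, whose
differential is onto along `S`. -/
structure IsDefiningMap (E : Type*) [NormedAddCommGroup E] [NormedSpace ℝ E]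
    {M : Type*} [TopologicalSpace M] [ChartedSpace E M]
    {W : Type*} [NormedAddCommGroup W] [NormedSpace ℝ W]
    (S U : Set M) (h : M → W) : Prop where
  isOpen : IsOpen U
  contMDiffOn : ContMDiffOn 𝓘(ℝ, E) 𝓘(ℝ, W) ∞ h U
  surjective : ∀ y ∈ S ∩ U, Function.Surjective (mfderiv 𝓘(ℝ, E) 𝓘(ℝ, W) h y)
  inter_eq : S ∩ U = {y ∈ U | h y = 0}

namespace IsDefiningMap

variable {S U : Set M} {h : M → W}

theorem contMDiffAt (hS : IsDefiningMap E S U h) {x : M} (hx : x ∈ U) :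
    ContMDiffAt 𝓘(ℝ, E) 𝓘(ℝ, W) ∞ h x :=
  hS.contMDiffOn.contMDiffAt (hS.isOpen.mem_nhds hx)

theorem mdifferentiableAt (hS : IsDefiningMap E S U h) {x : M} (hx : x ∈ U) :
    MDifferentiableAt 𝓘(ℝ, E) 𝓘(ℝ, W) h x :=
  (hS.contMDiffAt hx).mdifferentiableAt (by simp)

theorem mem_iff (hS : IsDefiningMap E S U h) {x : M} (hx : x ∈ U) : x ∈ S ↔ h x = 0 :=
  ⟨fun hxS => (hS.inter_eq.subset ⟨hxS, hx⟩).2, fun h0 => (hS.inter_eq.superset ⟨hx, h0⟩).1⟩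

theorem comp_continuousLinearEquiv {W' : Type*} [NormedAddCommGroup W'] [NormedSpace ℝ W']
    (hS : IsDefiningMap E S U h) (e : W ≃L[ℝ] W') : IsDefiningMap E S U (e ∘ h) where
  isOpen := hS.isOpen
  contMDiffOn := e.contDiff.contMDiff.comp_contMDiffOn hS.contMDiffOn
  surjective y hy := by
    have he : MDifferentiableAt 𝓘(ℝ, W) 𝓘(ℝ, W') e (h y) :=
      e.differentiableAt.mdifferentiableAt
    rw [mfderiv_comp y he (hS.mdifferentiableAt hy.2)]
    have h1 : Function.Surjective (mfderiv 𝓘(ℝ, W) 𝓘(ℝ, W') e (h y)) := by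
      rw [mfderiv_eq_fderiv, e.fderiv]
      exact e.surjective
    exact h1.comp (hS.surjective y hy)
  inter_eq := by
    rw [hS.inter_eq]
    ext y
    simp

/-- A linear functional of a defining map extends from a neighbourhood of a point to a smooth
function that vanishes on `S`. -/
theorem exists_extension [FiniteDimensional ℝ E] [T2Space M] [IsManifold 𝓘(ℝ, E) ∞ M]
    (hS : IsDefiningMap E S U h) {x : M} (hx : x ∈ U) (ℓ : W →L[ℝ] ℝ) :
    ∃ f : M → ℝ, ContMDiff 𝓘(ℝ, E) 𝓘(ℝ, ℝ) ∞ f ∧ (∀ y ∈ S, f y = 0) ∧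
      ∀ v, differential E f x v = ℓ (mfderiv 𝓘(ℝ, E) 𝓘(ℝ, W) h x v) := by
  obtain ⟨f, hf, hfe, hf0⟩ := exists_contMDiff_eventuallyEq_of_contMDiffOn hS.isOpen hx
    (ℓ.contDiff.contMDiff.comp_contMDiffOn hS.contMDiffOn)
  refine ⟨f, hf, fun y hy => hf0 y fun hyU => ?_, fun v => ?_⟩
  · simp [(hS.mem_iff hyU).1 hy]
  · unfold differential
    rw [hfe.mfderiv_eq, mfderiv_comp x ℓ.differentiableAt.mdifferentiableAt
      (hS.mdifferentiableAt hx), mfderiv_eq_fderiv, ℓ.fderiv]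
    rfl

/-- Components of `h` extend to global functions vanishing on `S`, so tangent vectors lie in the
kernel. Conversely, a function vanishing on `S` is constant on the zero fibre of `h`, so its
differential kills the kernel by the multiplier argument. -/
theorem mem_submanifoldTangent_iff [FiniteDimensional ℝ E] [T2Space M]
    [IsManifold 𝓘(ℝ, E) ∞ M] [CompleteSpace W]
    (hS : IsDefiningMap E S U h) {x : M} (hx : x ∈ S ∩ U) {v : TangentSpace 𝓘(ℝ, E) x} :
    v ∈ submanifoldTangent E S x ↔ mfderiv 𝓘(ℝ, E) 𝓘(ℝ, W) h x v = 0 := by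
  have : CompleteSpace E := FiniteDimensional.complete ℝ E
  constructor
  · intro hv
    refine SeparatingDual.eq_zero_of_forall_dual_eq_zero (R := ℝ) (V := W) fun ℓ => ?_
    obtain ⟨f, hf, hfS, hfd⟩ := hS.exists_extension hx.2 ℓ
    exact (hfd v).symm.trans (hv f hf hfS)
  · intro hv f hf hfS
    refine mfderiv_apply_eq_zero_of_constant_on_fibre (hS.contMDiffAt hx.2) (hf x)
      (hS.surjective x hx) ?_ hv
    filter_upwards [hS.isOpen.mem_nhds hx.2] with y hy hyx
    rw [hfS x hx.1, hfS y ((hS.mem_iff hy).2 (hyx.trans ((hS.mem_iff hx.2).1 hx.1)))]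

/-- Surjectivity is transversality: lift the target to `(w₁, w₂)` and split it as `(dμ₁ v, dμ₂ v)`
plus vectors tangent to `O₁` and `O₂`, which `dh₁` and `dh₂` kill. -/
theorem prod [FiniteDimensional ℝ E] [T2Space M] [IsManifold 𝓘(ℝ, E) ∞ M]
    [FiniteDimensional ℝ F] [T2Space N] [IsManifold 𝓘(ℝ, F) ∞ N]
    {F' : Type*} [NormedAddCommGroup F'] [NormedSpace ℝ F'] [FiniteDimensional ℝ F']
    {N' : Type*} [TopologicalSpace N'] [ChartedSpace F' N'] [T2Space N'] [IsManifold 𝓘(ℝ, F') ∞ N']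
    {W' : Type*} [NormedAddCommGroup W'] [NormedSpace ℝ W'] [CompleteSpace W] [CompleteSpace W']
    {O₁ U₁ : Set N} {O₂ U₂ : Set N'} {h₁ : N → W} {h₂ : N' → W'}
    (H₁ : IsDefiningMap F O₁ U₁ h₁) (H₂ : IsDefiningMap F' O₂ U₂ h₂) {μ₁ : M → N} {μ₂ : M → N'}
    (hμ₁ : ContMDiff 𝓘(ℝ, E) 𝓘(ℝ, F) ∞ μ₁) (hμ₂ : ContMDiff 𝓘(ℝ, E) 𝓘(ℝ, F') ∞ μ₂)
    (htrans : IsTransverseToProd F F' E μ₁ μ₂ O₁ O₂) :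
    IsDefiningMap E (μ₁ ⁻¹' O₁ ∩ μ₂ ⁻¹' O₂) (μ₁ ⁻¹' U₁ ∩ μ₂ ⁻¹' U₂)
      (fun x => (h₁ (μ₁ x), h₂ (μ₂ x))) where
  isOpen := (H₁.isOpen.preimage hμ₁.continuous).inter (H₂.isOpen.preimage hμ₂.continuous)
  contMDiffOn :=
    (H₁.contMDiffOn.comp hμ₁.contMDiffOn fun _ hx => hx.1).prodMk_space
      (H₂.contMDiffOn.comp hμ₂.contMDiffOn fun _ hx => hx.2)
  surjective := by
    rintro y ⟨⟨hy₁, hy₂⟩, hyU₁, hyU₂⟩ ⟨a, b⟩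
    have hd₁ := H₁.mdifferentiableAt hyU₁
    have hd₂ := H₂.mdifferentiableAt hyU₂
    have hm₁ : MDifferentiableAt 𝓘(ℝ, E) 𝓘(ℝ, F) μ₁ y := (hμ₁ y).mdifferentiableAt (by simp)
    have hm₂ : MDifferentiableAt 𝓘(ℝ, E) 𝓘(ℝ, F') μ₂ y := (hμ₂ y).mdifferentiableAt (by simp)
    obtain ⟨w₁, rfl⟩ := H₁.surjective _ ⟨hy₁, hyU₁⟩ a
    obtain ⟨w₂, rfl⟩ := H₂.surjective _ ⟨hy₂, hyU₂⟩ b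
    have hw : (w₁, w₂) ∈ (⊤ : Submodule ℝ
      (TangentSpace 𝓘(ℝ, F) (μ₁ y) × TangentSpace 𝓘(ℝ, F') (μ₂ y))) := trivial
    rw [← htrans y hy₁ hy₂, Submodule.mem_sup] at hw
    obtain ⟨_, ⟨v, rfl⟩, ⟨τ₁, τ₂⟩, ⟨hτ₁, hτ₂⟩, hsum⟩ := hw
    refine ⟨v, ?_⟩
    have hτ₁' := (H₁.mem_submanifoldTangent_iff ⟨hy₁, hyU₁⟩).1 hτ₁
    have hτ₂' := (H₂.mem_submanifoldTangent_iff ⟨hy₂, hyU₂⟩).1 hτ₂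
    have e₁ : mfderiv 𝓘(ℝ, E) 𝓘(ℝ, F) μ₁ y v + τ₁ = w₁ := congrArg Prod.fst hsum
    have e₂ : mfderiv 𝓘(ℝ, E) 𝓘(ℝ, F') μ₂ y v + τ₂ = w₂ := congrArg Prod.snd hsum
    rw [← e₁, ← e₂, map_add, map_add, hτ₁', hτ₂', add_zero, add_zero]
    exact mfderiv_prodMk_comp_apply hd₁ hd₂ hm₁ hm₂ v
  inter_eq := by
    ext y
    constructor
    · rintro ⟨⟨hy₁, hy₂⟩, hyU₁, hyU₂⟩
      exact ⟨⟨hyU₁, hyU₂⟩, Prod.ext ((H₁.mem_iff hyU₁).1 hy₁) ((H₂.mem_iff hyU₂).1 hy₂)⟩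
    · rintro ⟨⟨hyU₁, hyU₂⟩, hy⟩
      exact ⟨⟨(H₁.mem_iff hyU₁).2 (congrArg Prod.fst hy), (H₂.mem_iff hyU₂).2 (congrArg Prod.snd hy)⟩,
        hyU₁, hyU₂⟩

end IsDefiningMap

theorem isSubmanifold_of_isDefiningMap [FiniteDimensional ℝ W] {k : ℕ}
    (hk : Module.finrank ℝ W = k) {S : Set M}
    (hS : ∀ x ∈ S, ∃ (U : Set M) (h : M → W), x ∈ U ∧ IsDefiningMap E S U h) :
    IsSubmanifold E k S := by
  intro x hx
  obtain ⟨U, h, hxU, H⟩ := hS x hx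
  have e : W ≃L[ℝ] (Fin k → ℝ) := ContinuousLinearEquiv.ofFinrankEq (by simp [hk])
  have H' := H.comp_continuousLinearEquiv e
  exact ⟨U, e ∘ h, H'.isOpen, hxU, H'.contMDiffOn, H'.surjective, H'.inter_eq⟩

theorem IsSubmanifold.exists_isDefiningMap {k : ℕ} {S : Set M} (hS : IsSubmanifold E k S) {x : M}
    (hx : x ∈ S) : ∃ (U : Set M) (h : M → (Fin k → ℝ)), x ∈ U ∧ IsDefiningMap E S U h := by
  obtain ⟨U, h, hU, hxU, h1, h2, h3⟩ := hS x hx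
  exact ⟨U, h, hxU, hU, h1, h2, h3⟩

end DefiningMaps

/-! ### Images of saturated submanifolds under submersions -/

section Submersions

variable {E : Type*} [NormedAddCommGroup E] [NormedSpace ℝ E]
  {M : Type*} [TopologicalSpace M] [ChartedSpace E M]
  {F : Type*} [NormedAddCommGroup F] [NormedSpace ℝ F]
  {N : Type*} [TopologicalSpace N] [ChartedSpace F N]
  {W : Type*} [NormedAddCommGroup W] [NormedSpace ℝ W]
  {q : M → N}

theorem mfderiv_apply_mfderiv_section {V : Set N} {s : N → M} (hV : IsOpen V)
    (hs : ContMDiffOn 𝓘(ℝ, F) 𝓘(ℝ, E) ∞ s V) (hqs : ∀ y ∈ V, q (s y) = y)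
    (hq : ContMDiff 𝓘(ℝ, E) 𝓘(ℝ, F) ∞ q) {y : N} (hy : y ∈ V) {x : M} (hx : s y = x)
    (w : TangentSpace 𝓘(ℝ, F) y) :
    mfderiv 𝓘(ℝ, E) 𝓘(ℝ, F) q x (mfderiv 𝓘(ℝ, F) 𝓘(ℝ, E) s y w : E) = (w : F) := by
  have h1 := mfderiv_comp_apply_model (g := q) (f := s) (x := y)
    ((hq x).mdifferentiableAt (by simp))
    ((hs.contMDiffAt (hV.mem_nhds hy)).mdifferentiableAt (by simp)) hx w
  have h2 : q ∘ s =ᶠ[𝓝 y] id := by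
    filter_upwards [hV.mem_nhds hy] with z hz
    exact hqs z hz
  rw [← h1, h2.mfderiv_eq, mfderiv_id]
  rfl

variable [IsManifold 𝓘(ℝ, E) ∞ M] [IsManifold 𝓘(ℝ, F) ∞ N]

theorem Manifold.IsSubmersion.mfderiv_surjective (hq : Manifold.IsSubmersion 𝓘(ℝ, E) 𝓘(ℝ, F) ∞ q)
    (x : M) : Function.Surjective (mfderiv 𝓘(ℝ, E) 𝓘(ℝ, F) q x) := by
  obtain ⟨V, s, hV, hxV, hs, hsx, hqs⟩ := (hq.isSubmersionAt x).exists_section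
  exact fun w => ⟨_, mfderiv_apply_mfderiv_section hV hs hqs hq.contMDiff hxV hsx w⟩

/-- Locally `f = (f ∘ q) ∘ s` for a smooth section `s`. -/
theorem Manifold.IsSubmersion.contMDiff_of_comp
    (hq : Manifold.IsSubmersion 𝓘(ℝ, E) 𝓘(ℝ, F) ∞ q) (hsurj : Function.Surjective q) {f : N → W}
    (hf : ContMDiff 𝓘(ℝ, E) 𝓘(ℝ, W) ∞ (f ∘ q)) : ContMDiff 𝓘(ℝ, F) 𝓘(ℝ, W) ∞ f := by
  intro y
  obtain ⟨x, rfl⟩ := hsurj y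
  obtain ⟨V, s, hV, hxV, hs, -, hqs⟩ := (hq.isSubmersionAt x).exists_section
  have h1 : ContMDiffAt 𝓘(ℝ, F) 𝓘(ℝ, W) ∞ ((f ∘ q) ∘ s) (q x) :=
    (hf _).comp (q x) (hs.contMDiffAt (hV.mem_nhds hxV))
  refine h1.congr_of_eventuallyEq ?_
  filter_upwards [hV.mem_nhds hxV] with y hy
  simp [hqs y hy]

namespace IsDefiningMap

variable {S U : Set M} {h : M → W}

/-- By saturation, `h` vanishes on the part in `U` of the `q`-fibre through `x`. -/
theorem mfderiv_apply_eq_zero_of_saturated [CompleteSpace E] [CompleteSpace F]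
    (hS : IsDefiningMap E S U h) (hq : Manifold.IsSubmersion 𝓘(ℝ, E) 𝓘(ℝ, F) ∞ q)
    (hsat : ∀ x y, q x = q y → x ∈ S → y ∈ S) {x : M} (hx : x ∈ S ∩ U)
    {v : TangentSpace 𝓘(ℝ, E) x} (hv : mfderiv 𝓘(ℝ, E) 𝓘(ℝ, F) q x v = 0) :
    mfderiv 𝓘(ℝ, E) 𝓘(ℝ, W) h x v = 0 := by
  refine mfderiv_apply_eq_zero_of_constant_on_fibre (hq.contMDiff x) (hS.contMDiffAt hx.2)
    (hq.mfderiv_surjective x) ?_ hv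
  filter_upwards [hS.isOpen.mem_nhds hx.2] with y hy hyx
  rw [(hS.mem_iff hy).1 (hsat _ _ hyx.symm hx.1), (hS.mem_iff hx.2).1 hx.1]

/-- The vectors `ds (dq v)` and `v` differ by an element of `ker dq`, which `dh` kills. -/
theorem mfderiv_section_apply [CompleteSpace E] [CompleteSpace F]
    (hS : IsDefiningMap E S U h) (hq : Manifold.IsSubmersion 𝓘(ℝ, E) 𝓘(ℝ, F) ∞ q)
    (hsat : ∀ x y, q x = q y → x ∈ S → y ∈ S) {x : M} (hx : x ∈ S ∩ U)
    {V : Set N} {s : N → M} (hV : IsOpen V)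
    (hs : ContMDiffOn 𝓘(ℝ, F) 𝓘(ℝ, E) ∞ s V) (hqs : ∀ y ∈ V, q (s y) = y)
    (hxV : q x ∈ V) (hsx : s (q x) = x) (v : TangentSpace 𝓘(ℝ, E) x) :
    mfderiv 𝓘(ℝ, F) 𝓘(ℝ, W) (h ∘ s) (q x) (mfderiv 𝓘(ℝ, E) 𝓘(ℝ, F) q x v) =
      (mfderiv 𝓘(ℝ, E) 𝓘(ℝ, W) h x v : W) := by
  set w := mfderiv 𝓘(ℝ, E) 𝓘(ℝ, F) q x v with hw
  have h1 := mfderiv_comp_apply_model (g := h) (f := s) (x := q x) (hS.mdifferentiableAt hx.2)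
    ((hs.contMDiffAt (hV.mem_nhds hxV)).mdifferentiableAt (by simp)) hsx w
  refine h1.trans ?_
  have h2 := mfderiv_apply_mfderiv_section hV hs hqs hq.contMDiff hxV hsx w
  set v' : TangentSpace 𝓘(ℝ, E) x := mfderiv 𝓘(ℝ, F) 𝓘(ℝ, E) s (q x) w
  have h3 : mfderiv 𝓘(ℝ, E) 𝓘(ℝ, F) q x (v' - v) = 0 := by
    rw [map_sub, ← hw]
    exact sub_eq_zero.2 h2
  have h4 := hS.mfderiv_apply_eq_zero_of_saturated hq hsat hx h3
  rw [map_sub] at h4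
  exact sub_eq_zero.1 h4

/-- By saturation a point `y` of `V` lies in `q(S)` exactly when `s y` lies in `S`, so `h ∘ s` cuts
out the image. -/
theorem image_of_section [CompleteSpace E] [CompleteSpace F]
    (hS : IsDefiningMap E S U h) (hq : Manifold.IsSubmersion 𝓘(ℝ, E) 𝓘(ℝ, F) ∞ q)
    (hsat : ∀ x y, q x = q y → x ∈ S → y ∈ S)
    {V : Set N} {s : N → M} (hV : IsOpen V)
    (hs : ContMDiffOn 𝓘(ℝ, F) 𝓘(ℝ, E) ∞ s V) (hqs : ∀ y ∈ V, q (s y) = y) :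
    IsDefiningMap F (q '' S) (V ∩ s ⁻¹' U) (h ∘ s) := by
  have hmem : ∀ y ∈ V, y ∈ q '' S ↔ s y ∈ S := fun y hy =>
    ⟨fun ⟨x, hx, hxy⟩ => hsat x (s y) (hxy.trans (hqs y hy).symm) hx, fun h => ⟨s y, h, hqs y hy⟩⟩
  refine ⟨hs.continuousOn.isOpen_inter_preimage hV hS.isOpen,
    hS.contMDiffOn.comp (hs.mono Set.inter_subset_left) fun y hy => hy.2, ?_, ?_⟩
  · rintro y ⟨hyS, hyV, hyU⟩ a
    have hyS' := (hmem y hyV).1 hyS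
    obtain ⟨v, rfl⟩ := hS.surjective (s y) ⟨hyS', hyU⟩ a
    have hqy := hqs y hyV
    have h1 := hS.mfderiv_section_apply hq hsat ⟨hyS', hyU⟩ hV hs hqs (by rwa [hqy])
      (by rw [hqy]) v
    -- The vector found is based at `q (s y)`, equal to `y` only by a proof; this moves it to `y`.
    have key : ∀ y', y' = y → ∀ w : F, ∃ w' : F,
        (mfderiv 𝓘(ℝ, F) 𝓘(ℝ, W) (h ∘ s) y w' : W) =
          (mfderiv 𝓘(ℝ, F) 𝓘(ℝ, W) (h ∘ s) y' w : W) := by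
      rintro _ rfl w
      exact ⟨w, rfl⟩
    obtain ⟨w', hw'⟩ := key _ hqy (mfderiv 𝓘(ℝ, E) 𝓘(ℝ, F) q (s y) v)
    exact ⟨w', hw'.trans h1⟩
  · ext y
    constructor
    · rintro ⟨hyS, hyV, hyU⟩
      exact ⟨⟨hyV, hyU⟩, (hS.mem_iff hyU).1 ((hmem y hyV).1 hyS)⟩
    · rintro ⟨⟨hyV, hyU⟩, hy⟩
      exact ⟨(hmem y hyV).2 ((hS.mem_iff hyU).2 hy), hyV, hyU⟩

end IsDefiningMap

/-- The image of a saturated set with a local defining map under a submersion. -/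
theorem Manifold.IsSubmersion.isSubmanifold_image [CompleteSpace E] [CompleteSpace F]
    [FiniteDimensional ℝ W] (hq : Manifold.IsSubmersion 𝓘(ℝ, E) 𝓘(ℝ, F) ∞ q)
    {S : Set M} (hsat : ∀ x y, q x = q y → x ∈ S → y ∈ S)
    (hS : ∀ x ∈ S, ∃ (U : Set M) (h : M → W), x ∈ U ∧ IsDefiningMap E S U h) :
    IsSubmanifold F (Module.finrank ℝ W) (q '' S) := by
  refine isSubmanifold_of_isDefiningMap (W := W) rfl ?_
  rintro _ ⟨x, hx, rfl⟩
  obtain ⟨U, h, hxU, H⟩ := hS x hx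
  obtain ⟨V, s, hV, hxV, hs, hsx, hqs⟩ := (hq.isSubmersionAt x).exists_section
  exact ⟨V ∩ s ⁻¹' U, h ∘ s, ⟨hxV, by simpa [hsx] using hxU⟩,
    H.image_of_section hq hsat hV hs hqs⟩

/-- The two tangent spaces are the kernels of `dh` and `d(h ∘ s)`, and `d(h ∘ s) ∘ dq = dh` with
`dq` onto. -/
theorem Manifold.IsSubmersion.map_submanifoldTangent [FiniteDimensional ℝ E] [T2Space M]
    [FiniteDimensional ℝ F] [T2Space N] [CompleteSpace W]
    (hq : Manifold.IsSubmersion 𝓘(ℝ, E) 𝓘(ℝ, F) ∞ q)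
    {S U : Set M} (hsat : ∀ x y, q x = q y → x ∈ S → y ∈ S) {h : M → W}
    (H : IsDefiningMap E S U h) {x : M} (hx : x ∈ S ∩ U) :
    Submodule.map (mfderiv 𝓘(ℝ, E) 𝓘(ℝ, F) q x).toLinearMap (submanifoldTangent E S x) =
      submanifoldTangent F (q '' S) (q x) := by
  have : CompleteSpace E := FiniteDimensional.complete ℝ E
  have : CompleteSpace F := FiniteDimensional.complete ℝ F
  obtain ⟨V, s, hV, hxV, hs, hsx, hqs⟩ := (hq.isSubmersionAt x).exists_section
  have H' := H.image_of_section hq hsat hV hs hqs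
  have hx' : q x ∈ q '' S ∩ (V ∩ s ⁻¹' U) :=
    ⟨⟨x, hx.1, rfl⟩, hxV, by simpa [hsx] using hx.2⟩
  have hd := H.mfderiv_section_apply hq hsat hx hV hs hqs hxV hsx
  ext w
  rw [H'.mem_submanifoldTangent_iff hx', Submodule.mem_map]
  constructor
  · rintro ⟨v, hv, rfl⟩
    exact (hd v).trans ((H.mem_submanifoldTangent_iff hx).1 hv)
  · intro hw
    obtain ⟨v, rfl⟩ := hq.mfderiv_surjective x w
    exact ⟨v, (H.mem_submanifoldTangent_iff hx).2 ((hd v).symm.trans hw), rfl⟩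

end Submersions

/-! ### Consequences of coisotropy -/

section Coisotropic

variable {𝔤 : Type*} [LieRing 𝔤] [LieAlgebra ℝ 𝔤] {t : 𝔤 ⊗[ℝ] 𝔤} {𝔠 : LieSubalgebra ℝ 𝔤}

/-- Both functionals factor through `𝔤/𝔠`, so only the image of `t` in `𝔤/𝔠 ⊗ 𝔤/𝔠` is evaluated. -/
theorem IsCoisotropic.tensorEval_eq_zero (h𝔠 : IsCoisotropic t 𝔠) {ξ η : Module.Dual ℝ 𝔤}
    (hξ : ∀ u ∈ 𝔠, ξ u = 0) (hη : ∀ u ∈ 𝔠, η u = 0) : tensorEval t ξ η = 0 := by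
  let ξ' : Module.Dual ℝ (𝔤 ⧸ 𝔠.toSubmodule) := 𝔠.toSubmodule.liftQ ξ hξ
  let η' : Module.Dual ℝ (𝔤 ⧸ 𝔠.toSubmodule) := 𝔠.toSubmodule.liftQ η hη
  have key : TensorProduct.dualDistrib ℝ 𝔤 𝔤 (ξ ⊗ₜ[ℝ] η) =
      (TensorProduct.dualDistrib ℝ _ _ (ξ' ⊗ₜ[ℝ] η')).comp
        (TensorProduct.map 𝔠.toSubmodule.mkQ 𝔠.toSubmodule.mkQ) := by
    ext a b
    simp [ξ', η']
    rfl
  rw [tensorEval, key, LinearMap.comp_apply, h𝔠, map_zero]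

/-- Modulo `𝔠`, `t^♯ ξ` is the contraction of the vanishing image of `t` with the functional induced
by `ξ`. -/
theorem IsCoisotropic.tensorSharp_mem (h𝔠 : IsCoisotropic t 𝔠) {ξ : Module.Dual ℝ 𝔤}
    (hξ : ∀ u ∈ 𝔠, ξ u = 0) : tensorSharp t ξ ∈ 𝔠 := by
  let ξ' : Module.Dual ℝ (𝔤 ⧸ 𝔠.toSubmodule) := 𝔠.toSubmodule.liftQ ξ hξ
  have key : 𝔠.toSubmodule.mkQ ∘ₗ (TensorProduct.lid ℝ 𝔤).toLinearMap ∘ₗ LinearMap.rTensor 𝔤 ξ =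
      (TensorProduct.lid ℝ (𝔤 ⧸ 𝔠.toSubmodule)).toLinearMap ∘ₗ
        LinearMap.rTensor (𝔤 ⧸ 𝔠.toSubmodule) ξ' ∘ₗ
        (TensorProduct.map 𝔠.toSubmodule.mkQ 𝔠.toSubmodule.mkQ) := by
    ext a b
    simp [ξ']
    rfl
  have h1 := LinearMap.congr_fun key t
  have h2 : TensorProduct.map 𝔠.toSubmodule.mkQ 𝔠.toSubmodule.mkQ t = 0 := h𝔠
  simp only [LinearMap.comp_apply, h2, map_zero] at h1
  exact (Submodule.Quotient.mk_eq_zero _).1 h1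

theorem IsCoisotropic.cartanTrivector_eq_zero (h𝔠 : IsCoisotropic t 𝔠) {ξ η ζ : Module.Dual ℝ 𝔤}
    (hξ : ∀ u ∈ 𝔠, ξ u = 0) (hη : ∀ u ∈ 𝔠, η u = 0) (hζ : ∀ u ∈ 𝔠, ζ u = 0) :
    cartanTrivector t ξ η ζ = 0 := by
  rw [cartanTrivector, hζ _ (𝔠.lie_mem (h𝔠.tensorSharp_mem hξ) (h𝔠.tensorSharp_mem hη)), mul_zero]

end Coisotropic

/-! ### Descent of bivector fields along submersions -/

section Descent

variable {E : Type*} [NormedAddCommGroup E] [NormedSpace ℝ E]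
  {M : Type*} [TopologicalSpace M] [ChartedSpace E M]
  {F : Type*} [NormedAddCommGroup F] [NormedSpace ℝ F]
  {N : Type*} [TopologicalSpace N] [ChartedSpace F N]

theorem differential_comp {q : M → N} {f : N → ℝ} {x : M}
    (hf : MDifferentiableAt 𝓘(ℝ, F) 𝓘(ℝ, ℝ) f (q x)) (hq : MDifferentiableAt 𝓘(ℝ, E) 𝓘(ℝ, F) q x) :
    differential E (f ∘ q) x =
      (differential F f (q x)).comp (mfderiv 𝓘(ℝ, E) 𝓘(ℝ, F) q x) :=
  mfderiv_comp x hf hq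

theorem Bivector.contMDiff_bracket (π : Bivector E M) {f g : M → ℝ}
    (hf : ContMDiff 𝓘(ℝ, E) 𝓘(ℝ, ℝ) ∞ f) (hg : ContMDiff 𝓘(ℝ, E) 𝓘(ℝ, ℝ) ∞ g) :
    ContMDiff 𝓘(ℝ, E) 𝓘(ℝ, ℝ) ∞ (π.bracket f g) :=
  π.smooth f g hf hg

theorem Bivector.val_swap (π : Bivector E M) (x : M) (α β : Cotangent E x) :
    π.val x α β = -π.val x β α := by
  have h := π.alternating x (α + β)
  simp only [map_add, LinearMap.add_apply, π.alternating] at h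
  linarith

/-- The pull-back of covectors of the model space along the differential of `q` at `x`. -/
noncomputable def cotangentPullback (q : M → N) (x : M) : (F →L[ℝ] ℝ) →ₗ[ℝ] Cotangent E x where
  toFun α := ContinuousLinearMap.comp (M₂ := TangentSpace 𝓘(ℝ, F) (q x)) α
    (mfderiv 𝓘(ℝ, E) 𝓘(ℝ, F) q x)
  map_add' _ _ := rfl
  map_smul' _ _ := rfl

variable [IsManifold 𝓘(ℝ, E) ∞ M] [IsManifold 𝓘(ℝ, F) ∞ N]

/-- A bivector field descends along a surjective submersion if the brackets of functions that are
constant on the fibres are constant on the fibres. -/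
theorem Bivector.exists_descent [FiniteDimensional ℝ F] [T2Space N] (π : Bivector E M) {q : M → N}
    (hq : Manifold.IsSubmersion 𝓘(ℝ, E) 𝓘(ℝ, F) ∞ q) (hsurj : Function.Surjective q)
    (hinv : ∀ f g : N → ℝ, ContMDiff 𝓘(ℝ, F) 𝓘(ℝ, ℝ) ∞ f → ContMDiff 𝓘(ℝ, F) 𝓘(ℝ, ℝ) ∞ g →
      ∀ x y, q x = q y → π.bracket (f ∘ q) (g ∘ q) x = π.bracket (f ∘ q) (g ∘ q) y) :
    ∃ π' : Bivector F N, ∀ (x : M) (α β : Cotangent F (q x)),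
      π'.val (q x) α β = π.val x (α.comp (mfderiv 𝓘(ℝ, E) 𝓘(ℝ, F) q x))
        (β.comp (mfderiv 𝓘(ℝ, E) 𝓘(ℝ, F) q x)) := by
  have hpull : ∀ (f : N → ℝ), ContMDiff 𝓘(ℝ, F) 𝓘(ℝ, ℝ) ∞ f → ∀ x y, q x = y →
      cotangentPullback (F := F) q x (differential F f y) = differential E (f ∘ q) x := by
    rintro f hf x _ rfl
    exact (differential_comp ((hf _).mdifferentiableAt (by simp))
      ((hq.contMDiff x).mdifferentiableAt (by simp))).symm
  -- A set-theoretic section suffices: `hB` makes the value independent of the chosen point of the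
  -- fibre, and smoothness descends along `q`.
  let s : N → M := Function.surjInv hsurj
  have hs : ∀ y, q (s y) = y := Function.surjInv_eq hsurj
  let B : ∀ y : N, (F →L[ℝ] ℝ) →ₗ[ℝ] (F →L[ℝ] ℝ) →ₗ[ℝ] ℝ := fun y =>
    (π.val (s y)).compl₁₂ (cotangentPullback q (s y)) (cotangentPullback q (s y))
  have hB : ∀ f g : N → ℝ, ContMDiff 𝓘(ℝ, F) 𝓘(ℝ, ℝ) ∞ f → ContMDiff 𝓘(ℝ, F) 𝓘(ℝ, ℝ) ∞ g →
      ∀ x, B (q x) (differential F f (q x)) (differential F g (q x)) =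
        π.bracket (f ∘ q) (g ∘ q) x := by
    intro f g hf hg x
    rw [hinv f g hf hg x (s (q x)) (hs (q x)).symm]
    exact congrArg₂ (fun a b => π.val (s (q x)) a b) (hpull f hf _ _ (hs _)) (hpull g hg _ _ (hs _))
  refine ⟨⟨B, fun y α => π.alternating _ _, fun f g hf hg => ?_⟩, fun x α β => ?_⟩
  · refine hq.contMDiff_of_comp hsurj ?_
    have : (fun y => B y (differential F f y) (differential F g y)) ∘ q =
        π.bracket (f ∘ q) (g ∘ q) := funext fun x => hB f g hf hg x
    have h2 := π.contMDiff_bracket (hf.comp hq.contMDiff) (hg.comp hq.contMDiff)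
    rw [← this] at h2
    exact h2
  · obtain ⟨f, hf, rfl⟩ := exists_differential_eq (q x) α
    obtain ⟨g, hg, rfl⟩ := exists_differential_eq (q x) β
    refine (hB f g hf hg x).trans ?_
    rw [Bivector.bracket, ← hpull f hf x _ rfl, ← hpull g hg x _ rfl]
    rfl

end Descent

/-! ### Central maps and the reduced Poisson structure -/

section Reduction

variable {𝔤 : Type*} [LieRing 𝔤] [LieAlgebra ℝ 𝔤] {t : 𝔤 ⊗[ℝ] 𝔤}
  {E : Type*} [NormedAddCommGroup E] [NormedSpace ℝ E]
  {M : Type*} [TopologicalSpace M] [ChartedSpace E M] [IsManifold 𝓘(ℝ, E) ∞ M]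
  {E' : Type*} [NormedAddCommGroup E'] [NormedSpace ℝ E']
  {M' : Type*} [TopologicalSpace M'] [ChartedSpace E' M']
  {F : Type*} [NormedAddCommGroup F] [NormedSpace ℝ F]
  {N : Type*} [TopologicalSpace N] [ChartedSpace F N] [IsManifold 𝓘(ℝ, F) ∞ N]
  {Q : QuasiPoisson t E M} {R : QuasiPoisson t F N} {𝔠 : LieSubalgebra ℝ 𝔤} {q : M → M'}

theorem QuasiPoisson.IsEquivariant.pullback_comp_eq_zero {μ : M → N} (hμ : Q.IsEquivariant R μ)
    {x : M} {α : Cotangent F (μ x)} (hα : ∀ u ∈ 𝔠, α (R.ρ.field u (μ x)) = 0) {u : 𝔤} (hu : u ∈ 𝔠) :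
    Q.ρ.pullback (α.comp (mfderiv 𝓘(ℝ, E) 𝓘(ℝ, F) μ x)) u = 0 := by
  refine Eq.trans ?_ (hα u hu)
  exact congrArg α (hμ.map_field u x)

/-- Both covectors annihilate the `𝔠`-directions, so the `t` term of `σ` vanishes and centrality
becomes a statement about `π`. -/
theorem QuasiPoisson.IsLeftCentral.val_eq_zero [FiniteDimensional ℝ F] [T2Space N] {μ : M → N}
    (hμ : Q.IsLeftCentral R μ)
    (h𝔠 : IsCoisotropic t 𝔠) {x : M} {α : Cotangent F (μ x)}
    (hα : ∀ u ∈ 𝔠, α (R.ρ.field u (μ x)) = 0) {β : Cotangent E x}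
    (hβ : ∀ u ∈ 𝔠, β (Q.ρ.field u x) = 0) :
    Q.π.val x (α.comp (mfderiv 𝓘(ℝ, E) 𝓘(ℝ, F) μ x)) β = 0 := by
  obtain ⟨f, hf, rfl⟩ := exists_differential_eq (μ x) α
  have h1 := hμ.central f hf x β
  rw [differential_comp ((hf _).mdifferentiableAt (by simp))
    ((hμ.equivariant.smooth x).mdifferentiableAt (by simp)), σ, h𝔠.tensorEval_eq_zero
      (fun u hu => hμ.equivariant.pullback_comp_eq_zero hα hu) hβ, mul_zero, add_zero] at h1
  exact h1

theorem QuasiPoisson.IsRightCentral.val_eq_zero [FiniteDimensional ℝ F] [T2Space N] {μ : M → N}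
    (hμ : Q.IsRightCentral R μ)
    (h𝔠 : IsCoisotropic t 𝔠) {x : M} {α : Cotangent F (μ x)}
    (hα : ∀ u ∈ 𝔠, α (R.ρ.field u (μ x)) = 0) {β : Cotangent E x}
    (hβ : ∀ u ∈ 𝔠, β (Q.ρ.field u x) = 0) :
    Q.π.val x β (α.comp (mfderiv 𝓘(ℝ, E) 𝓘(ℝ, F) μ x)) = 0 := by
  obtain ⟨f, hf, rfl⟩ := exists_differential_eq (μ x) α
  have h1 := hμ.central f hf x β
  rw [differential_comp ((hf _).mdifferentiableAt (by simp))
    ((hμ.equivariant.smooth x).mdifferentiableAt (by simp)), σ, h𝔠.tensorEval_eq_zero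
      hβ (fun u hu => hμ.equivariant.pullback_comp_eq_zero hα hu), mul_zero, add_zero] at h1
  exact h1

variable [FiniteDimensional ℝ E] [T2Space M]

theorem LieAlgebraAction.IsQuotient.mfderiv_field {ρ : LieAlgebraAction 𝔤 E M}
    (hq : ρ.IsQuotient 𝔠 E' q) {u : 𝔤} (hu : u ∈ 𝔠) (x : M) :
    mfderiv 𝓘(ℝ, E) 𝓘(ℝ, E') q x (ρ.field u x) = 0 := by
  have : CompleteSpace E := FiniteDimensional.complete ℝ E
  exact ρ.mfderiv_field_eq_zero hu ((hq.submersion.contMDiff x).mdifferentiableAt (by simp))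
    fun y hy => ((hq.fibre x y).2 hy).symm

theorem LieAlgebraAction.IsQuotient.derive_comp {ρ : LieAlgebraAction 𝔤 E M}
    (hq : ρ.IsQuotient 𝔠 E' q) {u : 𝔤} (hu : u ∈ 𝔠) {f : M' → ℝ}
    (hf : ContMDiff 𝓘(ℝ, E') 𝓘(ℝ, ℝ) ∞ f) (x : M) : ρ.derive u (f ∘ q) x = 0 := by
  rw [derive, differential_comp ((hf _).mdifferentiableAt (by simp))
    ((hq.submersion.contMDiff x).mdifferentiableAt (by simp)), ContinuousLinearMap.comp_apply,
    hq.mfderiv_field hu, map_zero]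

/-- For `u ∈ 𝔠`, invariance of `π` gives `ρ(u){f, g} = {ρ(u)f, g} + {f, ρ(u)g}`, and pulled-back
functions have zero derivative along `ρ(u)`. -/
theorem QuasiPoisson.bracket_comp_eq (hq : Q.ρ.IsQuotient 𝔠 E' q) {f g : M' → ℝ}
    (hf : ContMDiff 𝓘(ℝ, E') 𝓘(ℝ, ℝ) ∞ f) (hg : ContMDiff 𝓘(ℝ, E') 𝓘(ℝ, ℝ) ∞ g) {x y : M}
    (hxy : q x = q y) :
    Q.π.bracket (f ∘ q) (g ∘ q) x = Q.π.bracket (f ∘ q) (g ∘ q) y := by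
  have hf' := hf.comp hq.submersion.contMDiff
  have hg' := hg.comp hq.submersion.contMDiff
  refine Q.ρ.eq_of_sameOrbit (𝔠 := 𝔠)
    ((Q.π.contMDiff_bracket hf' hg').mdifferentiable (by simp)) (fun u hu z => ?_)
    ((hq.fibre x y).1 hxy)
  have h0 : ∀ z, differential E (fun _ : M => (0 : ℝ)) z = 0 := fun z => mfderiv_const
  rw [Q.invariant u _ _ hf' hg', funext (hq.derive_comp hu hf), funext (hq.derive_comp hu hg)]
  simp [Bivector.bracket, h0]

/-- Pull-back along `q` intertwines the brackets, so the Jacobiator pulls back to `φ` on three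
covectors that annihilate the `𝔠`-directions. -/
theorem Bivector.isPoisson_of_descent (h𝔠 : IsCoisotropic t 𝔠) (hq : Q.ρ.IsQuotient 𝔠 E' q)
    {π' : Bivector E' M'} (hπ' : ∀ (x : M) (α β : Cotangent E' (q x)),
      π'.val (q x) α β = Q.π.val x (α.comp (mfderiv 𝓘(ℝ, E) 𝓘(ℝ, E') q x))
        (β.comp (mfderiv 𝓘(ℝ, E) 𝓘(ℝ, E') q x))) : π'.IsPoisson := by
  have hqs := hq.submersion.contMDiff
  have hbr : ∀ f g : M' → ℝ, ContMDiff 𝓘(ℝ, E') 𝓘(ℝ, ℝ) ∞ f → ContMDiff 𝓘(ℝ, E') 𝓘(ℝ, ℝ) ∞ g →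
      π'.bracket f g ∘ q = Q.π.bracket (f ∘ q) (g ∘ q) := by
    intro f g hf hg
    funext x
    have hqx := (hqs x).mdifferentiableAt (by simp : (∞ : WithTop ℕ∞) ≠ 0)
    simp only [Function.comp_apply, Bivector.bracket]
    rw [differential_comp ((hf _).mdifferentiableAt (by simp)) hqx,
      differential_comp ((hg _).mdifferentiableAt (by simp)) hqx, hπ']
  have hbr' : ∀ f g h : M' → ℝ, ContMDiff 𝓘(ℝ, E') 𝓘(ℝ, ℝ) ∞ f →
      ContMDiff 𝓘(ℝ, E') 𝓘(ℝ, ℝ) ∞ g → ContMDiff 𝓘(ℝ, E') 𝓘(ℝ, ℝ) ∞ h → ∀ x,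
      π'.bracket f (π'.bracket g h) (q x) =
        Q.π.bracket (f ∘ q) (Q.π.bracket (g ∘ q) (h ∘ q)) x := by
    intro f g h hf hg hh x
    rw [← hbr g h hg hh, ← hbr f _ hf (π'.contMDiff_bracket hg hh), Function.comp_apply]
  intro f g h hf hg hh y
  obtain ⟨x, rfl⟩ := hq.surjective y
  have h1 : π'.halfSchouten f g h (q x) = Q.π.halfSchouten (f ∘ q) (g ∘ q) (h ∘ q) x := by
    simp only [Bivector.halfSchouten]
    rw [hbr' f g h hf hg hh, hbr' g h f hg hh hf, hbr' h f g hh hf hg]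
  rw [h1, Q.schouten _ _ _ (hf.comp hqs) (hg.comp hqs) (hh.comp hqs)]
  exact h𝔠.cartanTrivector_eq_zero (fun u hu => hq.derive_comp hu hf x)
    (fun u hu => hq.derive_comp hu hg x) (fun u hu => hq.derive_comp hu hh x)

end Reduction

/-! ### Conormal covectors and the reduction theorem -/

/-- A covector that annihilates the tangent space of the preimage of `O₁ × O₂` is the sum of the
pull-backs of a conormal covector of `O₁` and a conormal covector of `O₂`. -/
theorem IsDefiningMap.exists_conormal_decomposition
    {E : Type*} [NormedAddCommGroup E] [NormedSpace ℝ E] [FiniteDimensional ℝ E]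
    {M : Type*} [TopologicalSpace M] [T2Space M] [ChartedSpace E M] [IsManifold 𝓘(ℝ, E) ∞ M]
    {F : Type*} [NormedAddCommGroup F] [NormedSpace ℝ F] [FiniteDimensional ℝ F]
    {N : Type*} [TopologicalSpace N] [T2Space N] [ChartedSpace F N] [IsManifold 𝓘(ℝ, F) ∞ N]
    {F' : Type*} [NormedAddCommGroup F'] [NormedSpace ℝ F'] [FiniteDimensional ℝ F']
    {N' : Type*} [TopologicalSpace N'] [ChartedSpace F' N'] [T2Space N'] [IsManifold 𝓘(ℝ, F') ∞ N']
    {W : Type*} [NormedAddCommGroup W] [NormedSpace ℝ W] [FiniteDimensional ℝ W]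
    {W' : Type*} [NormedAddCommGroup W'] [NormedSpace ℝ W'] [FiniteDimensional ℝ W']
    {O₁ U₁ : Set N} {O₂ U₂ : Set N'} {h₁ : N → W} {h₂ : N' → W'}
    (H₁ : IsDefiningMap F O₁ U₁ h₁) (H₂ : IsDefiningMap F' O₂ U₂ h₂) {μ₁ : M → N} {μ₂ : M → N'}
    (hμ₁ : ContMDiff 𝓘(ℝ, E) 𝓘(ℝ, F) ∞ μ₁) (hμ₂ : ContMDiff 𝓘(ℝ, E) 𝓘(ℝ, F') ∞ μ₂)
    (htrans : IsTransverseToProd F F' E μ₁ μ₂ O₁ O₂) {x : M} (hx₁ : μ₁ x ∈ O₁ ∩ U₁)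
    (hx₂ : μ₂ x ∈ O₂ ∩ U₂) {α : Cotangent E x}
    (hα : ∀ v ∈ submanifoldTangent E (μ₁ ⁻¹' O₁ ∩ μ₂ ⁻¹' O₂) x, α v = 0) :
    ∃ (α₁ : Cotangent F (μ₁ x)) (α₂ : Cotangent F' (μ₂ x)),
      (∀ v ∈ submanifoldTangent F O₁ (μ₁ x), α₁ v = 0) ∧
      (∀ v ∈ submanifoldTangent F' O₂ (μ₂ x), α₂ v = 0) ∧
      α = α₁.comp (mfderiv 𝓘(ℝ, E) 𝓘(ℝ, F) μ₁ x) + α₂.comp (mfderiv 𝓘(ℝ, E) 𝓘(ℝ, F') μ₂ x) := by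
  have : CompleteSpace W := FiniteDimensional.complete ℝ W
  have : CompleteSpace W' := FiniteDimensional.complete ℝ W'
  have H := H₁.prod H₂ hμ₁ hμ₂ htrans
  have hx : x ∈ (μ₁ ⁻¹' O₁ ∩ μ₂ ⁻¹' O₂) ∩ (μ₁ ⁻¹' U₁ ∩ μ₂ ⁻¹' U₂) :=
    ⟨⟨hx₁.1, hx₂.1⟩, hx₁.2, hx₂.2⟩
  let D : E →ₗ[ℝ] W × W' :=
    (mfderiv 𝓘(ℝ, E) 𝓘(ℝ, W × W') (fun x => (h₁ (μ₁ x), h₂ (μ₂ x))) x).toLinearMap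
  let a : E →ₗ[ℝ] ℝ := α.toLinearMap
  -- Since `ker D` is the tangent space, `α` factors as `(α ∘ r) ∘ D`; restricting `α ∘ r` to the
  -- two summands of `W × W'` gives `l₁` and `l₂`.
  obtain ⟨r, hr⟩ := D.exists_rightInverse_of_surjective (LinearMap.range_eq_top.2 (H.surjective x hx))
  have hker : ∀ v, D v = 0 → a v = 0 := fun v hv =>
    hα v ((H.mem_submanifoldTangent_iff hx).2 hv)
  have hfac : ∀ v, a v = a (r (D v)) := by
    intro v
    rw [← sub_eq_zero, ← map_sub]
    apply hker
    rw [map_sub, sub_eq_zero]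
    exact (LinearMap.congr_fun hr (D v)).symm
  let l₁ : W →L[ℝ] ℝ := LinearMap.toContinuousLinearMap (a ∘ₗ r ∘ₗ LinearMap.inl ℝ W W')
  let l₂ : W' →L[ℝ] ℝ := LinearMap.toContinuousLinearMap (a ∘ₗ r ∘ₗ LinearMap.inr ℝ W W')
  refine ⟨l₁.comp (mfderiv 𝓘(ℝ, F) 𝓘(ℝ, W) h₁ (μ₁ x)),
    l₂.comp (mfderiv 𝓘(ℝ, F') 𝓘(ℝ, W') h₂ (μ₂ x)), fun v hv => ?_, fun v hv => ?_, ?_⟩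
  · exact (congrArg l₁ ((H₁.mem_submanifoldTangent_iff hx₁).1 hv)).trans (map_zero l₁)
  · exact (congrArg l₂ ((H₂.mem_submanifoldTangent_iff hx₂).1 hv)).trans (map_zero l₂)
  · ext v
    refine (hfac v).trans ?_
    have hD : D v = _ := mfderiv_prodMk_comp_apply (H₁.mdifferentiableAt hx₁.2)
      (H₂.mdifferentiableAt hx₂.2) ((hμ₁ x).mdifferentiableAt (by simp))
      ((hμ₂ x).mdifferentiableAt (by simp)) v
    have hsplit : ∀ (w : W) (w' : W'), a (r (w, w')) = l₁ w + l₂ w' := by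
      intro w w'
      simp only [l₁, l₂, LinearMap.coe_toContinuousLinearMap', LinearMap.comp_apply,
        LinearMap.inl_apply, LinearMap.inr_apply, ← map_add, Prod.mk_add_mk, add_zero, zero_add]
    rw [hD]
    exact hsplit _ _

theorem mainTheorem1
    {𝔤 : Type*} [LieRing 𝔤] [LieAlgebra ℝ 𝔤] (t : 𝔤 ⊗[ℝ] 𝔤) (ht : IsInvariantSymmetric t)
    -- the manifolds `M`, `N_L`, `N_R` and `M' = M/𝔠`
    {E : Type*} [NormedAddCommGroup E] [NormedSpace ℝ E] [FiniteDimensional ℝ E]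
    {M : Type*} [TopologicalSpace M] [T2Space M] [SecondCountableTopology M]
    [ChartedSpace E M] [IsManifold 𝓘(ℝ, E) ∞ M]
    {FL : Type*} [NormedAddCommGroup FL] [NormedSpace ℝ FL] [FiniteDimensional ℝ FL]
    {NL : Type*} [TopologicalSpace NL] [T2Space NL] [SecondCountableTopology NL]
    [ChartedSpace FL NL] [IsManifold 𝓘(ℝ, FL) ∞ NL]
    {FR : Type*} [NormedAddCommGroup FR] [NormedSpace ℝ FR] [FiniteDimensional ℝ FR]
    {NR : Type*} [TopologicalSpace NR] [T2Space NR] [SecondCountableTopology NR]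
    [ChartedSpace FR NR] [IsManifold 𝓘(ℝ, FR) ∞ NR]
    {E' : Type*} [NormedAddCommGroup E'] [NormedSpace ℝ E'] [FiniteDimensional ℝ E']
    {M' : Type*} [TopologicalSpace M'] [T2Space M'] [SecondCountableTopology M']
    [ChartedSpace E' M'] [IsManifold 𝓘(ℝ, E') ∞ M']
    -- a central pair
    (Q : QuasiPoisson t E M) (QL : QuasiPoisson t FL NL) (QR : QuasiPoisson t FR NR)
    (μL : M → NL) (μR : M → NR) (hμ : Q.IsCentralPair QL QR μL μR)
    -- a coisotropic subalgebra and two invariant submanifolds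
    (𝔠 : LieSubalgebra ℝ 𝔤) (h𝔠 : IsCoisotropic t 𝔠)
    (kL kR : ℕ) (OL : Set NL) (OR : Set NR)
    (hOL : IsSubmanifold FL kL OL) (hOR : IsSubmanifold FR kR OR)
    (hOL_inv : QL.ρ.IsInvariantSet 𝔠 OL) (hOR_inv : QR.ρ.IsInvariantSet 𝔠 OR)
    (htrans : IsTransverseToProd FL FR E μL μR OL OR)
    -- `M/𝔠` is a manifold
    (q : M → M') (hq : Q.ρ.IsQuotient 𝔠 E' q) :
    -- `M/𝔠` carries the bivector field induced by `π`, and it is Poisson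
    ∃ π' : Bivector E' M',
      (∀ (x : M) (α β : Cotangent E' (q x)),
        π'.val (q x) α β =
          Q.π.val x (α.comp (mfderiv 𝓘(ℝ, E) 𝓘(ℝ, E') q x))
            (β.comp (mfderiv 𝓘(ℝ, E) 𝓘(ℝ, E') q x))) ∧
      π'.IsPoisson ∧
      -- `P = μ_L⁻¹(O_L) ∩ μ_R⁻¹(O_R)` is an invariant submanifold of `M`
      IsSubmanifold E (kL + kR) (μL ⁻¹' OL ∩ μR ⁻¹' OR) ∧
      Q.ρ.IsInvariantSet 𝔠 (μL ⁻¹' OL ∩ μR ⁻¹' OR) ∧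
      -- `P/𝔠`, the image of `P`, is a Poisson submanifold of `M/𝔠`, and `P → P/𝔠` is a submersion
      IsPoissonSubmanifold π' (kL + kR) (q '' (μL ⁻¹' OL ∩ μR ⁻¹' OR)) ∧
      (∀ x ∈ μL ⁻¹' OL ∩ μR ⁻¹' OR,
        Submodule.map (mfderiv 𝓘(ℝ, E) 𝓘(ℝ, E') q x).toLinearMap
            (submanifoldTangent E (μL ⁻¹' OL ∩ μR ⁻¹' OR) x) =
          submanifoldTangent E' (q '' (μL ⁻¹' OL ∩ μR ⁻¹' OR)) (q x)) := by
  have : CompleteSpace E := FiniteDimensional.complete ℝ E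
  have : CompleteSpace E' := FiniteDimensional.complete ℝ E'
  have hL := hμ.left
  have hR := hμ.right
  set P : Set M := μL ⁻¹' OL ∩ μR ⁻¹' OR with hP
  have hPinv : Q.ρ.IsInvariantSet 𝔠 P := fun x y hxy hx =>
    ⟨hL.equivariant.isInvariantSet_preimage hOL_inv x y hxy hx.1,
      hR.equivariant.isInvariantSet_preimage hOR_inv x y hxy hx.2⟩
  have hsat : ∀ x y, q x = q y → x ∈ P → y ∈ P := fun x y hxy hx =>
    hPinv x y ((hq.fibre x y).1 hxy) hx
  have hdef : ∀ x ∈ P, ∃ (U : Set M) (h : M → (Fin kL → ℝ) × (Fin kR → ℝ)),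
      x ∈ U ∧ IsDefiningMap E P U h := by
    intro x hx
    obtain ⟨UL, hL', hxL, HL⟩ := hOL.exists_isDefiningMap hx.1
    obtain ⟨UR, hR', hxR, HR⟩ := hOR.exists_isDefiningMap hx.2
    exact ⟨μL ⁻¹' UL ∩ μR ⁻¹' UR, _, ⟨hxL, hxR⟩, HL.prod HR hL.equivariant.smooth hR.equivariant.smooth htrans⟩
  have hfin : Module.finrank ℝ ((Fin kL → ℝ) × (Fin kR → ℝ)) = kL + kR := by simp
  have htan : ∀ x ∈ P, Submodule.map (mfderiv 𝓘(ℝ, E) 𝓘(ℝ, E') q x).toLinearMap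
      (submanifoldTangent E P x) = submanifoldTangent E' (q '' P) (q x) := by
    intro x hx
    obtain ⟨U, h, hxU, H⟩ := hdef x hx
    exact hq.submersion.map_submanifoldTangent hsat H ⟨hx, hxU⟩
  obtain ⟨π', hπ'⟩ := Q.π.exists_descent hq.submersion hq.surjective
    fun f g hf hg x y hxy => Q.bracket_comp_eq hq hf hg hxy
  refine ⟨π', hπ', Bivector.isPoisson_of_descent h𝔠 hq hπ',
    isSubmanifold_of_isDefiningMap hfin hdef, hPinv,
    ⟨hfin ▸ hq.submersion.isSubmanifold_image hsat hdef, ?_⟩, htan⟩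
  rintro _ ⟨x, hx, rfl⟩ α β hα
  rw [hπ' x]
  have hβ : ∀ u ∈ 𝔠, (β.comp (mfderiv 𝓘(ℝ, E) 𝓘(ℝ, E') q x)) (Q.ρ.field u x) = 0 :=
    fun u hu => by rw [ContinuousLinearMap.comp_apply, hq.mfderiv_field hu, map_zero]
  -- As `dq` maps the tangent space of `P` into that of `q(P)`, a conormal covector of `q(P)` pulls
  -- back to one of `P`.
  have hα' : ∀ v ∈ submanifoldTangent E P x, α (mfderiv 𝓘(ℝ, E) 𝓘(ℝ, E') q x v) = 0 :=
    fun v hv => hα _ (htan x hx ▸ Submodule.mem_map_of_mem hv)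
  obtain ⟨UL, fL, hxL, HL⟩ := hOL.exists_isDefiningMap hx.1
  obtain ⟨UR, fR, hxR, HR⟩ := hOR.exists_isDefiningMap hx.2
  obtain ⟨αL, αR, hαL, hαR, hsum⟩ := HL.exists_conormal_decomposition HR
    (α := α.comp (mfderiv 𝓘(ℝ, E) 𝓘(ℝ, E') q x)) hL.equivariant.smooth
    hR.equivariant.smooth htrans ⟨hx.1, hxL⟩ ⟨hx.2, hxR⟩ hα'
  have : CompleteSpace FL := FiniteDimensional.complete ℝ FL
  have : CompleteSpace FR := FiniteDimensional.complete ℝ FR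
  -- Right-centrality concerns the second slot, so the right summand is first moved there by
  -- antisymmetry.
  rw [hsum, map_add, LinearMap.add_apply,
    hL.val_eq_zero h𝔠 (fun u hu => hαL _ (hOL_inv.field_mem_submanifoldTangent hu hx.1)) hβ,
    Q.π.val_swap,
    hR.val_eq_zero h𝔠 (fun u hu => hαR _ (hOR_inv.field_mem_submanifoldTangent hu hx.2)) hβ,
    neg_zero, add_zero]
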